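/- Let $N\ge 1$, $s\in(0,1)$, $p\in(1,\infty)$. Write $a^{q}:=|a|^{q-1}a$ for $a\in\mathbb R$, $q>0$, $a_+=\max\{a,0\}$, $B_r$ for the open ball of radius $r$ centred at $0$, and $\mathbb R^N_+=\{x: x\cdot e_N>0\}$. **Definitions.** For $U\subseteq\mathbb R^N$ open let $$\|u\|_{W^{s,p}(U)}=\|u\|_{L^p(U)}+\Big(\int_{U\times U}\frac{|u(x)-u(y)|^p}{|x-y|^{N+ps}}\,dx\,dy\Big)^{1/p},$$ let $W^{s,p}_0(\Omega)=\{\varphi\in W^{s,p}(\mathbb R^N):\varphi=0\text{ a.e. in }\Omega^c\}$ and let $W^{-s,p'}(\Omega)$ be its dual. For bounded $\Omega$, $\widetilde W^{s,p}(\Omega)$ is the set of all $u\in L^p_{\rm loc}(\mathbb R^N)$ such that, for some open $U\supseteq\overline\Omega$, $$\|u\|_{W^{s,p}(U)}+\int_{\mathbb R^N}\frac{|u(x)|^{p-1}}{(1+|x|)^{N+ps}}\,dx<\infty.$$ For unbounded $\Omega$, $\widetilde W^{s,p}_{\rm loc}(\Omega)$ is the set of all $u\in L^p_{\rm loc}(\mathbb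 R^N)$ with $u\in\widetilde W^{s,p}(\Omega')$ for every bounded $\Omega'\subseteq\Omega$. For a bounded open $\Omega$, $u$ is a weak solution of $(-\Delta)_p^su=f$ in $\Omega$ if $u\in\widetilde W^{s,p}(\Omega)$, the functional $\varphi\mapsto\int_\Omega f\varphi\,dx$ belongs to $W^{-s,p'}(\Omega)$ and, for all $\varphi\in W^{s,p}_0(\Omega)$, $$\int_{\mathbb R^N\times\mathbb R^N}\frac{(u(x)-u(y))^{p-1}(\varphi(x)-\varphi(y))}{|x-y|^{N+ps}}\,dx\,dy=\int_\Omega f\varphi\,dx,$$ the integrals being absolutely convergent. For an unbounded open $\Omega$, $u\in\widetilde W^{s,p}_{\rm loc}(\Omega)$ is a weak solution in $\Omega$ if it is one in every bounded open $\Omega'\subseteq\Omega$. A $C^{1,1}$ diffeomorphism of $\mathbb R^N$ is a bijection $\Phi$ of $\mathbb R^N$ such that $\Phi$ and $\Phi^{-1}$ are continuously differentiable with globally Lipschitz derivatives; then $D^2\Phi$ exists almost everywhere and is essentially bounded. Norms of derivatives are taken in $L^\infty(\mathbb R^N)$. **Lemma (change of variables).** For all $M,M'\ge 0$ and $r>0$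 there is a constant $C$, depending only on $N,p,s,M,M',r$, such that the following holds for every $C^{1,1}$ diffeomorphism $\Phi$ of $\mathbb R^N$ with $\Phi(x)=x$ for all $x\notin B_r$, $\|D\Phi\|_\infty\le M$ and $\|D\Phi^{-1}\|_\infty\le M'$. The function $$v(x)=\big(\Phi^{-1}(x)\cdot e_N\big)_+^s$$ belongs to $\widetilde W^{s,p}_{\rm loc}(\mathbb R^N)$, and there is $f\in L^\infty(\Phi(\mathbb R^N_+))$ such that $v$ is a weak solution of $(-\Delta)_p^sv=f$ in $\Phi(\mathbb R^N_+)$ and $$\|f\|_{L^\infty(\Phi(\mathbb R^N_+))}\le C\,\|D^2\Phi\|_\infty.$$ -/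

import Mathlib

open MeasureTheory
open scoped ENNReal NNReal

namespace FracPLap

/-- Euclidean space `ℝ^N`. -/
abbrev E (N : ℕ) : Type := EuclideanSpace ℝ (Fin N)

/-- The signed power `a ↦ |a|^(q-1) a`. -/
noncomputable def spow (a q : ℝ) : ℝ := |a| ^ (q - 1) * a

/-- The density `|u(x) - u(y)|^p / |x - y|^(N + p s)` of the Gagliardo seminorm. -/
noncomputable def gagliardo {N : ℕ} (s p : ℝ) (u : E N → ℝ) (z : E N × E N) : ℝ :=
  |u z.1 - u z.2| ^ p / ‖z.1 - z.2‖ ^ ((N : ℝ) + p * s)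

/-- The norm `‖u‖_{W^{s,p}(U)}`, with values in `[0, ∞]`. -/
noncomputable def wNorm {N : ℕ} (s p : ℝ) (U : Set (E N)) (u : E N → ℝ) : ℝ≥0∞ :=
  eLpNorm u (ENNReal.ofReal p) (volume.restrict U) +
    (∫⁻ z in U ×ˢ U, ENNReal.ofReal (gagliardo s p u z)) ^ (1 / p)

/-- `φ ∈ W^{s,p}_0(Ω)`: `φ ∈ W^{s,p}(ℝ^N)` and `φ = 0` (almost everywhere) in `Ω^c`. -/
def MemW0 {N : ℕ} (s p : ℝ) (Ω : Set (E N)) (φ : E N → ℝ) : Prop :=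
  AEStronglyMeasurable φ volume ∧ wNorm s p Set.univ φ < ∞ ∧ ∀ᵐ x, x ∉ Ω → φ x = 0

/-- `u ∈ L^p_loc(ℝ^N)`. -/
def MemLpLoc {N : ℕ} (p : ℝ) (u : E N → ℝ) : Prop :=
  ∀ K : Set (E N), IsCompact K → MemLp u (ENNReal.ofReal p) (volume.restrict K)

/-- `u ∈ W̃^{s,p}(Ω)`, for bounded `Ω`: `u ∈ L^p_loc(ℝ^N)`, there is an open `U ⋑ Ω` with
`‖u‖_{W^{s,p}(U)} < ∞`, and `∫ |u|^(p-1) / (1 + |x|)^(N + p s) dx < ∞`. -/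
def MemWTilde {N : ℕ} (s p : ℝ) (Ω : Set (E N)) (u : E N → ℝ) : Prop :=
  MemLpLoc p u ∧
    ∃ U : Set (E N), IsOpen U ∧ closure Ω ⊆ U ∧
      wNorm s p U u +
        ∫⁻ x : E N, ENNReal.ofReal (|u x| ^ (p - 1) / (1 + ‖x‖) ^ ((N : ℝ) + p * s)) < ∞

/-- `u ∈ W̃^{s,p}_loc(Ω)`, for unbounded `Ω`. -/
def MemWTildeLoc {N : ℕ} (s p : ℝ) (Ω : Set (E N)) (u : E N → ℝ) : Prop :=
  MemLpLoc p u ∧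
    ∀ Ω' : Set (E N), Bornology.IsBounded Ω' → Ω' ⊆ Ω → MemWTilde s p Ω' u

/-- The function `f` belongs to the dual `W^{-s,p'}(Ω)` of `W^{s,p}_0(Ω)`: the pairing
`φ ↦ ∫_Ω f φ` is a well-defined bounded functional on `W^{s,p}_0(Ω)`. -/
def MemDual {N : ℕ} (s p : ℝ) (Ω : Set (E N)) (f : E N → ℝ) : Prop :=
  (∀ φ : E N → ℝ, MemW0 s p Ω φ → IntegrableOn (fun x => f x * φ x) Ω) ∧
    ∃ K : ℝ≥0, ∀ φ : E N → ℝ, MemW0 s p Ω φ →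
      ‖∫ x in Ω, f x * φ x‖ₑ ≤ K * wNorm s p Set.univ φ

/-- The integrand `(u(x) - u(y))^(p-1) (φ(x) - φ(y)) / |x - y|^(N + p s)`
of the weak formulation. -/
noncomputable def weakForm {N : ℕ} (s p : ℝ) (u φ : E N → ℝ) (z : E N × E N) : ℝ :=
  spow (u z.1 - u z.2) (p - 1) * (φ z.1 - φ z.2) / ‖z.1 - z.2‖ ^ ((N : ℝ) + p * s)

/-- `u` is a weak solution of `(-Δ)_p^s u = f` in the bounded open set `Ω`. The integrability
of the integrand is recorded, so that its Bochner integral is the genuine one. -/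
def IsWeakSolBounded {N : ℕ} (s p : ℝ) (Ω : Set (E N)) (u f : E N → ℝ) : Prop :=
  MemWTilde s p Ω u ∧ MemDual s p Ω f ∧
    ∀ φ : E N → ℝ, MemW0 s p Ω φ →
      Integrable (weakForm s p u φ) ∧
        ∫ z : E N × E N, weakForm s p u φ z = ∫ x in Ω, f x * φ x

/-- `u` is a weak solution of `(-Δ)_p^s u = f` in the unbounded open set `Ω`: it is one in every
bounded open subset. -/
def IsWeakSol {N : ℕ} (s p : ℝ) (Ω : Set (E N)) (u f : E N → ℝ) : Prop :=
  MemWTildeLoc s p Ω u ∧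
    ∀ Ω' : Set (E N), IsOpen Ω' → Bornology.IsBounded Ω' → Ω' ⊆ Ω →
      IsWeakSolBounded s p Ω' u f

/-- Maps of class `C^{1,1}`: continuously differentiable with globally Lipschitz derivative. -/
def IsC11 {N : ℕ} (g : E N → E N) : Prop :=
  ContDiff ℝ 1 g ∧ ∃ L : ℝ≥0, LipschitzWith L (fderiv ℝ g)

/-- A bijection of `ℝ^N` that is a `C^{1,1}` diffeomorphism. -/
def IsC11Diffeo {N : ℕ} (Φ : E N ≃ E N) : Prop :=
  IsC11 Φ ∧ IsC11 Φ.symm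

/-- The norm `‖Dg‖_∞`. -/
noncomputable def supD {N : ℕ} (g : E N → E N) : ℝ≥0∞ :=
  eLpNorm (fderiv ℝ g) ∞ volume

/-- The norm `‖D²g‖_∞`. For `g` of class `C^{1,1}` the second derivative exists almost everywhere;
`fderiv` is `0` on the exceptional null set, which the essential supremum ignores. -/
noncomputable def supD2 {N : ℕ} (g : E N → E N) : ℝ≥0∞ :=
  eLpNorm (fderiv ℝ (fderiv ℝ g)) ∞ volume

/-- The last coordinate `x_N = x · e_N`, for `N ≥ 1`. -/
def lastCoord {N : ℕ} (hN : 1 ≤ N) (x : E N) : ℝ :=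
  x ⟨N - 1, Nat.sub_one_lt_of_lt hN⟩

/-- The open half-space `ℝ^N_+ = {x | x_N > 0}`. -/
def halfSpace {N : ℕ} (hN : 1 ≤ N) : Set (E N) :=
  {x | 0 < lastCoord hN x}

end FracPLap

/-!
Let `a` be the height `a(x) = Φ⁻¹(x) · e_N`, so that the function in question is `a_+ ^ s`.
The principal value is regularized by cutting the interaction of `x` and `y` off when the ratio of
`a(x)` and `a(y)` lies between `l` and `1 / l`; the cutoff is symmetric and scale invariant, and
`l ↑ 1` at the end. After the change of variables `y = Φ(z)` the kernel
`|det DΦ(z)| |Φ(w) - Φ(z)|^(-N-ps)` is the kernel with coefficients frozen at `w`, plus an error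
`kernelDiff`.

* Integrating out the tangential variables, the frozen kernel gives the one-dimensional operator
  applied to `t_+ ^ s`. By homogeneity its truncation is `a ^ (-s)` times a constant, and this
  constant tends to `0` because `(-Δ)_p^s (t_+ ^ s) = 0` on the half-line.
* The error is at most `C ‖D²Φ‖ min(|w - z|, R) |w - z|^(-N-ps)`, so its contribution converges
  absolutely. Doubled, this contribution is `f`.

Hardy's inequality makes `a ^ (-s)` integrable against test functions, which dominates the passage
to the limit in the weak formulation.
-/

namespace FracPLap

open Set Filter Topology Module

section PosPow

/-- The profile `b ↦ b_+^s`. -/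
noncomputable def posPow (s b : ℝ) : ℝ := (max b 0) ^ s

lemma posPow_of_nonpos {s b : ℝ} (hs : s ≠ 0) (hb : b ≤ 0) : posPow s b = 0 := by
  rw [posPow, max_eq_right hb, Real.zero_rpow hs]

lemma posPow_of_nonneg {s b : ℝ} (hb : 0 ≤ b) : posPow s b = b ^ s := by
  rw [posPow, max_eq_left hb]

lemma monotone_posPow {s : ℝ} (hs : 0 ≤ s) : Monotone (posPow s) := fun a b h => by
  unfold posPow
  gcongr

lemma continuous_posPow {s : ℝ} (hs : 0 ≤ s) : Continuous (posPow s) :=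
  (continuous_id.max continuous_const).rpow_const fun _ => Or.inr hs

lemma posPow_mul {s a b : ℝ} (ha : 0 ≤ a) : posPow s (a * b) = a ^ s * posPow s b := by
  unfold posPow
  rw [← Real.mul_rpow ha (le_max_right _ _), mul_max_of_nonneg _ _ ha, mul_zero]

lemma abs_posPow_sub_le {s : ℝ} (hs0 : 0 ≤ s) (hs1 : s ≤ 1) (a b : ℝ) :
    |posPow s a - posPow s b| ≤ |a - b| ^ s := by
  wlog h : b ≤ a generalizing a b
  · rw [abs_sub_comm, abs_sub_comm a b]
    exact this b a (le_of_not_ge h)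
  rw [abs_of_nonneg (sub_nonneg.2 (monotone_posPow hs0 h)), abs_of_nonneg (sub_nonneg.2 h),
    sub_le_iff_le_add]
  have hmax : max a 0 ≤ (a - b) + max b 0 :=
    max_le (by linarith [le_max_left b 0]) (by linarith [le_max_right b 0])
  exact (Real.rpow_le_rpow (le_max_right _ _) hmax hs0).trans
    (Real.rpow_add_le_add_rpow (sub_nonneg.2 h) (le_max_right _ _) hs0 hs1)

lemma abs_one_sub_posPow_le {s : ℝ} (hs0 : 0 < s) (hs1 : s ≤ 1) (t : ℝ) :
    |1 - posPow s t| ≤ |1 - t| := by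
  rcases le_total t 0 with h | h
  · rw [posPow_of_nonpos hs0.ne' h, sub_zero, abs_one, abs_of_nonneg (by linarith)]
    linarith
  rw [posPow_of_nonneg h]
  rcases le_total t 1 with h1 | h1
  · have : t ≤ t ^ s := Real.self_le_rpow_of_le_one h h1 hs1
    rw [abs_of_nonneg (sub_nonneg.2 (Real.rpow_le_one h h1 hs0.le)),
      abs_of_nonneg (sub_nonneg.2 h1)]
    linarith
  · have : t ^ s ≤ t := Real.rpow_le_self_of_one_le h1 hs1
    rw [abs_of_nonpos (sub_nonpos.2 (Real.one_le_rpow h1 hs0.le)),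
      abs_of_nonpos (sub_nonpos.2 h1)]
    linarith

lemma abs_posPow_sub_le_mul {s : ℝ} (hs0 : 0 < s) (hs1 : s ≤ 1) {a : ℝ} (ha : 0 < a) (b : ℝ) :
    |posPow s a - posPow s b| ≤ a ^ (s - 1) * |a - b| := by
  have hscale : posPow s a - posPow s b = a ^ s * (1 - posPow s (b / a)) := by
    rw [mul_sub, ← posPow_mul ha.le, mul_div_cancel₀ b ha.ne', posPow_of_nonneg ha.le, mul_one]
  rw [hscale, abs_mul, abs_of_nonneg (Real.rpow_nonneg ha.le s)]
  calc a ^ s * |1 - posPow s (b / a)| ≤ a ^ s * |1 - b / a| := by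
        exact mul_le_mul_of_nonneg_left (abs_one_sub_posPow_le hs0 hs1 _) (by positivity)
    _ = a ^ (s - 1) * |a - b| := by
      rw [Real.rpow_sub_one ha.ne', one_sub_div ha.ne', abs_div, abs_of_pos ha]
      field_simp

/-- Interpolates the `s`-Hölder bound (used `p - 1` times) with the Lipschitz bound (used once);
the exponent of `|a - b|` then exceeds `s * p`, at the cost of a singularity at the origin. -/
lemma abs_posPow_sub_rpow_le_of_pos {s p : ℝ} (hs0 : 0 < s) (hs1 : s ≤ 1) (hp : 1 ≤ p) {a : ℝ}
    (ha : 0 < a) (b : ℝ) :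
    |posPow s a - posPow s b| ^ p ≤ |a - b| ^ (s * p + (1 - s)) * a ^ (s - 1) := by
  calc |posPow s a - posPow s b| ^ p
      = |posPow s a - posPow s b| ^ (p - 1) * |posPow s a - posPow s b| := by
        rw [← Real.rpow_add_one' (abs_nonneg _) (by linarith), sub_add_cancel]
    _ ≤ (|a - b| ^ s) ^ (p - 1) * (a ^ (s - 1) * |a - b|) :=
        mul_le_mul (Real.rpow_le_rpow (abs_nonneg _) (abs_posPow_sub_le hs0.le hs1 a b)
          (by linarith)) (abs_posPow_sub_le_mul hs0 hs1 ha b) (abs_nonneg _) (by positivity)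
    _ = (|a - b| ^ (s * (p - 1)) * |a - b|) * a ^ (s - 1) := by
        rw [← Real.rpow_mul (abs_nonneg _)]
        ring
    _ = |a - b| ^ (s * p + (1 - s)) * a ^ (s - 1) := by
        rw [← Real.rpow_add_one' (abs_nonneg _) (by nlinarith)]
        ring_nf

lemma abs_posPow_sub_rpow_le {s p : ℝ} (hs0 : 0 < s) (hs1 : s ≤ 1) (hp : 1 ≤ p) (a b : ℝ) :
    |posPow s a - posPow s b| ^ p ≤
      |a - b| ^ (s * p + (1 - s)) * (|a| ^ (s - 1) + |b| ^ (s - 1)) := by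
  wlog h : b ≤ a generalizing a b
  · rw [abs_sub_comm, abs_sub_comm a b, add_comm (|a| ^ (s - 1))]
    exact this b a (le_of_not_ge h)
  rcases lt_or_ge 0 a with ha | ha
  · refine (abs_posPow_sub_rpow_le_of_pos hs0 hs1 hp ha b).trans ?_
    rw [abs_of_pos ha]
    gcongr
    exact le_add_of_nonneg_right (by positivity)
  · rw [posPow_of_nonpos hs0.ne' ha, posPow_of_nonpos hs0.ne' (h.trans ha), sub_zero, abs_zero,
      Real.zero_rpow (by linarith)]
    positivity

end PosPow

section SignedPower

lemma abs_spow {a q : ℝ} (hq : q ≠ 0) : |spow a q| = |a| ^ q := by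
  rw [spow, abs_mul, abs_of_nonneg (Real.rpow_nonneg (abs_nonneg a) _),
    ← Real.rpow_add_one' (abs_nonneg _) (by simpa using hq), sub_add_cancel]

lemma spow_of_nonneg {a q : ℝ} (hq : q ≠ 0) (ha : 0 ≤ a) : spow a q = a ^ q := by
  rw [spow, abs_of_nonneg ha, ← Real.rpow_add_one' ha (by simpa using hq), sub_add_cancel]

lemma spow_neg (a q : ℝ) : spow (-a) q = -spow a q := by
  rw [spow, abs_neg, mul_neg, spow]

lemma spow_mul {a b q : ℝ} (hq : q ≠ 0) (ha : 0 ≤ a) : spow (a * b) q = a ^ q * spow b q := by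
  rw [← spow_of_nonneg hq ha, spow, spow, spow, abs_mul,
    Real.mul_rpow (abs_nonneg a) (abs_nonneg b)]
  ring

@[fun_prop]
lemma measurable_spow (q : ℝ) : Measurable fun a => spow a q := by
  unfold spow
  fun_prop

end SignedPower

section Radial

variable {F : Type*} [NormedAddCommGroup F] [NormedSpace ℝ F] [FiniteDimensional ℝ F]
  [MeasurableSpace F] [BorelSpace F] (μ : Measure F) [μ.IsAddHaarMeasure]

lemma integral_indicator_Ici_norm_rpow {s R : ℝ} (hR : 0 < R) :
    ∫ h : F, (Ici R).indicator (fun y => y ^ (-(finrank ℝ F : ℝ) - s)) ‖h‖ ∂μ =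
      R ^ (-s) * ∫ h : F, (Ici 1).indicator (fun y => y ^ (-(finrank ℝ F : ℝ) - s)) ‖h‖ ∂μ := by
  set k : ℝ → F → ℝ := fun r h => (Ici r).indicator (fun y => y ^ (-(finrank ℝ F : ℝ) - s)) ‖h‖
  have hscale : ∀ h : F, k R (R • h) = R ^ (-(finrank ℝ F : ℝ) - s) * k 1 h := fun h => by
    simp only [k, indicator_apply, mem_Ici, norm_smul, Real.norm_of_nonneg hR.le, mul_ite,
      mul_zero, Real.mul_rpow hR.le (norm_nonneg _), le_mul_iff_one_le_right hR]
  have h := Measure.integral_comp_smul μ (k R) R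
  simp_rw [hscale] at h
  rw [integral_const_mul, abs_of_pos (by positivity), smul_eq_mul,
    eq_inv_mul_iff_mul_eq₀ (by positivity), ← mul_assoc, ← Real.rpow_natCast,
    ← Real.rpow_add hR, ← add_sub_assoc, add_neg_cancel, zero_sub] at h
  exact h.symm

variable [Nontrivial F]

lemma integrable_norm_rpow_mul_iff {k : ℝ → ℝ} {b : ℝ} :
    Integrable (fun h : F => k ‖h‖ * ‖h‖ ^ (-(finrank ℝ F : ℝ) + b)) μ ↔
      IntegrableOn (fun y => k y * y ^ (b - 1)) (Ioi 0) := by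
  rw [integrable_fun_norm_addHaar μ (f := fun y => k y * y ^ (-(finrank ℝ F : ℝ) + b))]
  refine integrableOn_congr_fun (fun y hy => ?_) measurableSet_Ioi
  have hd : 1 ≤ finrank ℝ F := finrank_pos
  rw [smul_eq_mul, mul_left_comm, ← Real.rpow_natCast, ← Real.rpow_add hy, Nat.cast_sub hd]
  push_cast
  ring_nf

lemma integrable_indicator_Ici_norm_rpow {s R : ℝ} (hs : 0 < s) (hR : 0 < R) :
    Integrable
      (fun h : F => (Ici R).indicator (fun y => y ^ (-(finrank ℝ F : ℝ) - s)) ‖h‖) μ := by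
  have h := (integrable_norm_rpow_mul_iff μ (F := F) (k := (Ici R).indicator 1) (b := -s)).2 ?_
  · refine h.congr (Eventually.of_forall fun h => ?_)
    simp only [indicator_apply, Pi.one_apply, ite_mul, one_mul, zero_mul, sub_eq_add_neg]
  have htail : IntegrableOn (fun y : ℝ => y ^ (-s - 1)) (Ici R) :=
    (integrableOn_Ici_iff_integrableOn_Ioi).2 (integrableOn_Ioi_rpow_of_lt (by linarith) hR)
  refine ((integrable_indicator_iff measurableSet_Ici).2 htail).integrableOn.congr_fun
    (fun y _ => ?_) measurableSet_Ioi
  simp only [indicator_apply, Pi.one_apply, ite_mul, one_mul, zero_mul]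

lemma integrable_indicator_Iio_norm_rpow {b : ℝ} (hb : 0 < b) (R : ℝ) :
    Integrable
      (fun h : F => (Iio R).indicator (fun y => y ^ (-(finrank ℝ F : ℝ) + b)) ‖h‖) μ := by
  have h := (integrable_norm_rpow_mul_iff μ (F := F) (k := (Iio R).indicator 1) (b := b)).2 ?_
  · refine h.congr (Eventually.of_forall fun h => ?_)
    simp only [indicator_apply, Pi.one_apply, ite_mul, one_mul, zero_mul]
  have hhead : IntegrableOn (fun y : ℝ => y ^ (b - 1)) (Ioo 0 R) := by
    rcases le_or_gt R 0 with hR | hR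
    · simp [Ioo_eq_empty (not_lt.2 hR)]
    refine IntegrableOn.mono_set ?_ Ioo_subset_Ioc_self
    rw [← intervalIntegrable_iff_integrableOn_Ioc_of_le hR.le]
    exact intervalIntegral.intervalIntegrable_rpow' (by linarith)
  refine ((integrable_indicator_iff measurableSet_Ioo).2 hhead).integrableOn.congr_fun
    (fun y hy => ?_) measurableSet_Ioi
  simp only [indicator_apply, mem_Ioo, mem_Iio, (show 0 < y from hy), true_and, Pi.one_apply,
    ite_mul, one_mul, zero_mul]

lemma integrable_min_norm_mul_rpow {s : ℝ} (hs0 : 0 < s) (hs1 : s < 1) (R : ℝ) (hR : 0 < R) :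
    Integrable (fun h : F => min ‖h‖ R * ‖h‖ ^ (-(finrank ℝ F : ℝ) - s)) μ := by
  refine ((integrable_indicator_Iio_norm_rpow μ (sub_pos.2 hs1) R).add
    ((integrable_indicator_Ici_norm_rpow μ hs0 hR).const_mul R)).congr
    (Eventually.of_forall fun h => ?_)
  have hd : (1 : ℝ) ≤ finrank ℝ F := mod_cast (finrank_pos : 0 < finrank ℝ F)
  rcases lt_or_ge ‖h‖ R with hR' | hR'
  · simp only [Pi.add_apply, indicator, mem_Iio, mem_Ici, hR', not_le.2 hR', if_true, if_false,
      mul_zero, add_zero, min_eq_left hR'.le]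
    rw [mul_comm, ← Real.rpow_add_one' (norm_nonneg _) (by linarith)]
    ring_nf
  · simp only [Pi.add_apply, indicator, mem_Iio, mem_Ici, hR', not_lt.2 hR', if_true, if_false,
      zero_add, min_eq_right hR']

end Radial

section Truncation

/-- The off-diagonal region `b ≤ l a` or `a ≤ l b`. For `l < 1` it omits a sector around the
diagonal of the positive quadrant; it is symmetric and scale invariant, so that truncating a
homogeneous antisymmetric kernel to it keeps both properties. -/
def OffDiag (l a b : ℝ) : Prop := b ≤ l * a ∨ a ≤ l * b

lemma OffDiag.comm {l a b : ℝ} : OffDiag l a b ↔ OffDiag l b a := or_comm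

lemma OffDiag.mul_iff {l a b c : ℝ} (hc : 0 < c) : OffDiag l (c * a) (c * b) ↔ OffDiag l a b := by
  unfold OffDiag
  rw [mul_left_comm, mul_le_mul_iff_right₀ hc, mul_left_comm l c b, mul_le_mul_iff_right₀ hc]

lemma OffDiag.le_abs_sub {l a b : ℝ} (hl0 : 0 ≤ l) (hl1 : l ≤ 1) (ha : 0 < a)
    (h : OffDiag l a b) : (1 - l) * a ≤ |a - b| := by
  rcases h with h | h
  · exact le_trans (by linarith) (le_abs_self _)
  · have hb : 0 < b := pos_of_mul_pos_right (ha.trans_le h) hl0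
    have hab : a ≤ b := h.trans (mul_le_of_le_one_left hb.le hl1)
    rw [abs_sub_comm, abs_of_nonneg (sub_nonneg.2 hab)]
    nlinarith

lemma measurableSet_offDiag (l : ℝ) : MeasurableSet {z : ℝ × ℝ | OffDiag l z.1 z.2} :=
  (measurableSet_le measurable_snd (measurable_fst.const_mul l)).union
    (measurableSet_le measurable_fst (measurable_snd.const_mul l))

open Classical in
/-- The numerator `(a_+^s - b_+^s)^(p-1)` of the one-dimensional operator acting on `b ↦ b_+^s`,
truncated to the off-diagonal region. -/
noncomputable def truncInt (s p l a b : ℝ) : ℝ :=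
  if OffDiag l a b then spow (posPow s a - posPow s b) (p - 1) else 0

variable {s p l a b : ℝ}

lemma truncInt_of_offDiag (h : OffDiag l a b) :
    truncInt s p l a b = spow (posPow s a - posPow s b) (p - 1) := if_pos h

lemma truncInt_of_not_offDiag (h : ¬OffDiag l a b) : truncInt s p l a b = 0 := if_neg h

lemma measurable_truncInt (hs : 0 ≤ s) (p l : ℝ) :
    Measurable fun z : ℝ × ℝ => truncInt s p l z.1 z.2 := by
  have hmeas : Measurable (posPow s) := (continuous_posPow hs).measurable
  exact Measurable.ite (measurableSet_offDiag l) (by fun_prop) measurable_const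

lemma truncInt_mul {c : ℝ} (hp : p ≠ 1) (hc : 0 < c) :
    truncInt s p l (c * a) (c * b) = c ^ (s * (p - 1)) * truncInt s p l a b := by
  by_cases h : OffDiag l a b
  · rw [truncInt_of_offDiag h, truncInt_of_offDiag ((OffDiag.mul_iff hc).2 h),
      posPow_mul hc.le, posPow_mul hc.le, ← mul_sub,
      spow_mul (sub_ne_zero.2 hp) (Real.rpow_nonneg hc.le _), ← Real.rpow_mul hc.le]
  · rw [truncInt_of_not_offDiag h,
      truncInt_of_not_offDiag (mt (OffDiag.mul_iff hc).1 h), mul_zero]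

lemma truncInt_symm : truncInt s p l b a = -truncInt s p l a b := by
  by_cases h : OffDiag l a b
  · rw [truncInt_of_offDiag h, truncInt_of_offDiag (OffDiag.comm.1 h), ← neg_sub, spow_neg]
  · rw [truncInt_of_not_offDiag h, truncInt_of_not_offDiag (mt OffDiag.comm.1 h), neg_zero]

lemma abs_spow_posPow_sub_le (hs0 : 0 ≤ s) (hs1 : s ≤ 1) (hp : 1 < p) (a b : ℝ) :
    |spow (posPow s a - posPow s b) (p - 1)| ≤ |a - b| ^ (s * (p - 1)) := by
  rw [abs_spow (sub_pos.2 hp).ne', Real.rpow_mul (abs_nonneg _)]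
  exact Real.rpow_le_rpow (abs_nonneg _) (abs_posPow_sub_le hs0 hs1 a b) (sub_pos.2 hp).le

lemma abs_truncInt_le (hs0 : 0 ≤ s) (hs1 : s ≤ 1) (hp : 1 < p) (l a b : ℝ) :
    |truncInt s p l a b| ≤ |a - b| ^ (s * (p - 1)) := by
  unfold truncInt
  split_ifs
  · exact abs_spow_posPow_sub_le hs0 hs1 hp a b
  · rw [abs_zero]
    positivity

lemma eventually_truncInt_eq (s p a b : ℝ) :
    ∀ᶠ l in 𝓝[<] 1, truncInt s p l a b = spow (posPow s a - posPow s b) (p - 1) := by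
  have hlim : ∀ c : ℝ, Tendsto (· * c) (𝓝[<] 1) (𝓝 c) := fun c => by
    simpa using (continuous_mul_const c).continuousWithinAt.tendsto (x := 1) (s := Iio 1)
  rcases lt_trichotomy a b with h | rfl | h
  · filter_upwards [(hlim b).eventually (eventually_gt_nhds h)] with l hl
    exact truncInt_of_offDiag (Or.inr hl.le)
  · exact Eventually.of_forall fun l => by simp [truncInt, spow]
  · filter_upwards [(hlim a).eventually (eventually_gt_nhds h)] with l hl
    exact truncInt_of_offDiag (Or.inl hl.le)

lemma integrable_truncInt_mul (hs0 : 0 < s) (hs1 : s ≤ 1) (hp : 1 < p) (hl0 : 0 ≤ l)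
    (hl1 : l < 1) : Integrable fun t => truncInt s p l 1 t * |1 - t| ^ (-1 - p * s) := by
  have hmeas : Measurable (truncInt s p l 1) :=
    (measurable_truncInt hs0.le p l).comp measurable_prodMk_left
  have h := (integrable_indicator_Ici_norm_rpow (F := ℝ) volume hs0 (sub_pos.2 hl1)).comp_sub_left 1
  refine h.mono' (hmeas.mul (by fun_prop)).aestronglyMeasurable
    (Eventually.of_forall fun t => ?_)
  simp only [finrank_self, Nat.cast_one, Real.norm_eq_abs]
  by_cases ht : OffDiag l 1 t
  · have hlt : 1 - l ≤ |1 - t| := by simpa using ht.le_abs_sub hl0 hl1.le one_pos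
    have hpos : 0 < |1 - t| := (sub_pos.2 hl1).trans_le hlt
    rw [indicator_of_mem (by exact hlt), abs_mul, abs_of_nonneg (Real.rpow_nonneg hpos.le _)]
    calc |truncInt s p l 1 t| * |1 - t| ^ (-1 - p * s)
        ≤ |1 - t| ^ (s * (p - 1)) * |1 - t| ^ (-1 - p * s) := by
          gcongr
          exact abs_truncInt_le hs0.le hs1 hp l 1 t
      _ = |1 - t| ^ (-1 - s) := by
          rw [← Real.rpow_add hpos]
          ring_nf
  · rw [truncInt_of_not_offDiag ht, zero_mul, abs_zero]
    exact indicator_nonneg (fun y (hy : 1 - l ≤ y) =>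
      Real.rpow_nonneg ((sub_pos.2 hl1).le.trans hy) _) _

end Truncation

section OneDimensional

lemma integral_Ioi_eq_integral_Ioo_add_inv {G : Type*} [NormedAddCommGroup G] [NormedSpace ℝ G]
    {g : ℝ → G} (hg : IntegrableOn g (Ioi 0)) :
    ∫ x in Ioi 0, g x = ∫ x in Ioo 0 1, (g x + x ^ (-2 : ℝ) • g x⁻¹) := by
  have hinv : ∀ x ∈ Ioi (0 : ℝ), (|(-1 : ℝ)| * x ^ ((-1 : ℝ) - 1)) •
      (Ioi 1).indicator g (x ^ (-1 : ℝ)) =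
        (Ioo 0 1).indicator (fun x => x ^ (-2 : ℝ) • g x⁻¹) x := by
    intro x (hx : 0 < x)
    rw [Real.rpow_neg_one, abs_neg, abs_one, one_mul]
    norm_num [indicator_apply, hx, one_lt_inv₀ hx]
  have hgt : IntegrableOn ((Ioi 1).indicator g) (Ioi 0) := hg.indicator measurableSet_Ioi
  have hinv_int : IntegrableOn (fun x => x ^ (-2 : ℝ) • g x⁻¹) (Ioo 0 1) := by
    have h := (((integrableOn_Ioi_comp_rpow_iff _ (by norm_num)).2 hgt).congr_fun hinv
      measurableSet_Ioi).mono_set (Ioo_subset_Ioi_self : Ioo (0 : ℝ) 1 ⊆ _)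
    exact h.congr_fun (fun x hx => indicator_of_mem hx _) measurableSet_Ioo
  rw [integral_add (hg.mono_set Ioo_subset_Ioi_self) hinv_int, ← integral_Ioc_eq_integral_Ioo,
    ← Ioc_union_Ioi_eq_Ioi zero_le_one, setIntegral_union Ioc_disjoint_Ioi_same measurableSet_Ioi
      (hg.mono_set Ioc_subset_Ioi_self) (hg.mono_set (Ioi_subset_Ioi zero_le_one))]
  congr 1
  calc ∫ x in Ioi 1, g x = ∫ x in Ioi 0, (Ioi 1).indicator g x := by
        rw [setIntegral_indicator measurableSet_Ioi,
          inter_eq_right.2 (Ioi_subset_Ioi (zero_le_one' ℝ))]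
    _ = ∫ x in Ioi 0, (Ioo 0 1).indicator (fun x => x ^ (-2 : ℝ) • g x⁻¹) x := by
        rw [← integral_comp_rpow_Ioi _ (by norm_num : (-1 : ℝ) ≠ 0)]
        exact setIntegral_congr_fun measurableSet_Ioi hinv
    _ = ∫ x in Ioo 0 1, x ^ (-2 : ℝ) • g x⁻¹ := by
        rw [setIntegral_indicator measurableSet_Ioo, inter_eq_right.2 Ioo_subset_Ioi_self]

lemma integral_Iic_one_sub_rpow {q : ℝ} (hq : 0 < q) :
    ∫ t in Iic (0 : ℝ), (1 - t) ^ (-1 - q) = 1 / q := by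
  have hshift := (volume.measurePreserving_sub_left (1 : ℝ)).setIntegral_preimage_emb
    (Homeomorph.subLeft 1).measurableEmbedding (fun t => t ^ (-1 - q)) (Ici 1)
  rw [preimage_const_sub_Ici, sub_self, integral_Ici_eq_integral_Ioi,
    integral_Ioi_rpow_of_lt (by linarith) one_pos] at hshift
  rw [hshift, Real.one_rpow, show -1 - q + 1 = -q by ring, neg_div_neg_eq]

/-- The value at `1` of the truncated one-dimensional operator acting on `b ↦ b_+^s`, see
`integral_truncInt_one`. -/
noncomputable def truncConst (s p l : ℝ) : ℝ := (1 - l ^ s) ^ p * (1 - l) ^ (-(p * s)) / (p * s)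

variable {s p l : ℝ}

lemma truncConst_zero (hs : s ≠ 0) (p : ℝ) : truncConst s p 0 = 1 / (p * s) := by
  simp [truncConst, hs]

lemma truncConst_nonneg (hs : 0 ≤ s) (hp : 0 ≤ p) (hl0 : 0 ≤ l) (hl1 : l ≤ 1) :
    0 ≤ truncConst s p l := by
  have : 0 ≤ 1 - l ^ s := sub_nonneg.2 (Real.rpow_le_one hl0 hl1 hs)
  have : 0 ≤ 1 - l := sub_nonneg.2 hl1
  unfold truncConst
  positivity

lemma truncConst_le (hs0 : 0 < s) (hs1 : s ≤ 1) (hp : 0 ≤ p) (hl0 : 0 ≤ l) (hl1 : l < 1) :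
    truncConst s p l ≤ (1 - l) ^ (p * (1 - s)) / (p * s) := by
  have hle : 1 - l ^ s ≤ 1 - l := by
    linarith [Real.self_le_rpow_of_le_one hl0 hl1.le hs1]
  have hnonneg : 0 ≤ 1 - l ^ s := sub_nonneg.2 (Real.rpow_le_one hl0 hl1.le hs0.le)
  have hpos : 0 < 1 - l := sub_pos.2 hl1
  unfold truncConst
  rw [show p * (1 - s) = p + -(p * s) by ring, Real.rpow_add hpos]
  gcongr

lemma truncConst_le_inv (hs0 : 0 < s) (hs1 : s ≤ 1) (hp : 0 ≤ p) (hl0 : 0 ≤ l) (hl1 : l < 1) :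
    truncConst s p l ≤ 1 / (p * s) := by
  refine (truncConst_le hs0 hs1 hp hl0 hl1).trans ?_
  gcongr
  exact Real.rpow_le_one (by linarith) (by linarith) (mul_nonneg hp (sub_nonneg.2 hs1))

lemma tendsto_truncConst (hs0 : 0 < s) (hs1 : s < 1) (hp : 0 < p) :
    Tendsto (truncConst s p) (𝓝[<] 1) (𝓝 0) := by
  have hmem : ∀ᶠ l : ℝ in 𝓝[<] 1, l ∈ Ioo (0 : ℝ) 1 := Ioo_mem_nhdsLT one_pos
  have hexp : 0 < p * (1 - s) := mul_pos hp (sub_pos.2 hs1)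
  have hbound : Tendsto (fun l : ℝ => (1 - l) ^ (p * (1 - s)) / (p * s)) (𝓝[<] 1) (𝓝 0) := by
    have hcont : Continuous fun l : ℝ => (1 - l) ^ (p * (1 - s)) / (p * s) :=
      ((continuous_const.sub continuous_id).rpow_const fun _ => Or.inr hexp.le).div_const _
    simpa [Real.zero_rpow hexp.ne'] using (hcont.tendsto 1).mono_left nhdsWithin_le_nhds
  refine tendsto_of_tendsto_of_tendsto_of_le_of_le' tendsto_const_nhds hbound ?_ ?_
  · filter_upwards [hmem] with l hl using truncConst_nonneg hs0.le hp.le hl.1.le hl.2.le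
  · filter_upwards [hmem] with l hl using truncConst_le hs0 hs1.le hp.le hl.1.le hl.2

lemma hasDerivAt_truncConst (hs : 0 < s) (hp : p ≠ 0) {x : ℝ} (hx0 : 0 < x)
    (hx1 : x < 1) :
    HasDerivAt (truncConst s p)
      ((1 - x ^ s) ^ (p - 1) * (1 - x) ^ (-1 - p * s) * (1 - x ^ (s - 1))) x := by
  have hxs : 0 < 1 - x ^ s := sub_pos.2 (Real.rpow_lt_one hx0.le hx1 hs)
  have hx : 0 < 1 - x := sub_pos.2 hx1
  have hpow := ((Real.hasDerivAt_rpow_const (p := s) (Or.inl hx0.ne')).const_sub 1).rpow_const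
    (p := p) (Or.inl hxs.ne')
  have hlin := ((hasDerivAt_id x).const_sub 1).rpow_const (p := -(p * s)) (Or.inl hx.ne')
  refine ((hpow.mul hlin).div_const (p * s)).congr_deriv ?_
  have e1 : (1 - x ^ s) ^ p = (1 - x ^ s) ^ (p - 1) * (1 - x ^ s) := by
    rw [← Real.rpow_add_one hxs.ne', sub_add_cancel]
  have e2 : (1 - x) ^ (-(p * s)) = (1 - x) ^ (-1 - p * s) * (1 - x) := by
    rw [← Real.rpow_add_one hx.ne']
    ring_nf
  have e3 : x ^ s = x ^ (s - 1) * x := by rw [← Real.rpow_add_one hx0.ne', sub_add_cancel]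
  simp only [id, e1, e2, show -(p * s) - 1 = -1 - p * s by ring]
  have : p * s ≠ 0 := mul_ne_zero hp hs.ne'
  field_simp
  rw [e3]
  ring

lemma integral_deriv_truncConst (hs0 : 0 < s) (hs1 : s ≤ 1) (hp : 0 < p) (hl0 : 0 ≤ l)
    (hl1 : l < 1) :
    ∫ x in Ioc 0 l, (1 - x ^ s) ^ (p - 1) * (1 - x) ^ (-1 - p * s) * (1 - x ^ (s - 1)) =
      truncConst s p l - truncConst s p 0 := by
  have hcont : ContinuousOn (truncConst s p) (Icc 0 l) :=
    ((continuousOn_const.sub (continuousOn_id.rpow_const fun x _ => Or.inr hs0.le)).rpow_const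
      fun x _ => Or.inr hp.le).mul ((continuousOn_const.sub continuousOn_id).rpow_const
        fun x hx => Or.inl (sub_pos.2 (hx.2.trans_lt hl1)).ne') |>.div_const _
  have hderiv : ∀ x ∈ Ioo 0 l, HasDerivAt (truncConst s p)
      ((1 - x ^ s) ^ (p - 1) * (1 - x) ^ (-1 - p * s) * (1 - x ^ (s - 1))) x :=
    fun x hx => hasDerivAt_truncConst hs0 hp.ne' hx.1 (hx.2.trans hl1)
  -- the derivative has a sign, hence is integrable
  have hint := intervalIntegral.integrableOn_deriv_of_nonneg hcont.neg
    (fun x hx => (hderiv x hx).neg) fun x hx => by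
      have hx1 := hx.2.trans hl1
      have : 0 ≤ 1 - x ^ s := sub_nonneg.2 (Real.rpow_le_one hx.1.le hx1.le hs0.le)
      have : 0 ≤ 1 - x := sub_nonneg.2 hx1.le
      have hone : 1 ≤ x ^ (s - 1) :=
        Real.one_le_rpow_of_pos_of_le_one_of_nonpos hx.1 hx1.le (by linarith)
      rw [← mul_neg, neg_sub]
      have : 0 ≤ x ^ (s - 1) - 1 := sub_nonneg.2 hone
      positivity
  rw [← intervalIntegral.integral_of_le hl0]
  refine intervalIntegral.integral_eq_sub_of_hasDerivAt_of_le hl0 hcont hderiv ?_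
  rw [intervalIntegrable_iff_integrableOn_Ioc_of_le hl0]
  simpa using hint.neg

lemma integral_Iic_truncInt_one (hs : 0 < s) (hp : 1 < p) (hl : 0 ≤ l) :
    ∫ t in Iic 0, truncInt s p l 1 t * |1 - t| ^ (-1 - p * s) = truncConst s p 0 := by
  rw [truncConst_zero hs.ne', ← integral_Iic_one_sub_rpow (by positivity : 0 < p * s)]
  refine setIntegral_congr_fun measurableSet_Iic fun t (ht : t ≤ 0) => ?_
  rw [truncInt_of_offDiag (Or.inl (by linarith)), posPow_of_nonpos hs.ne' ht,
    posPow_of_nonneg zero_le_one, Real.one_rpow, sub_zero,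
    spow_of_nonneg (sub_pos.2 hp).ne' zero_le_one, Real.one_rpow, one_mul,
    abs_of_nonneg (by linarith)]

lemma truncInt_one_inv_mul (hp : p ≠ 1) {x : ℝ} (hx : 0 < x) :
    x ^ (-2 : ℝ) * (truncInt s p l 1 x⁻¹ * |1 - x⁻¹| ^ (-1 - p * s)) =
      -(x ^ (s - 1) * (truncInt s p l 1 x * |1 - x| ^ (-1 - p * s))) := by
  have hnum : truncInt s p l 1 x⁻¹ = -(x ^ (-(s * (p - 1))) * truncInt s p l 1 x) := by
    have h := truncInt_mul (s := s) (l := l) (a := x) (b := 1) hp (inv_pos.2 hx)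
    rwa [inv_mul_cancel₀ hx.ne', mul_one, Real.inv_rpow hx.le, ← Real.rpow_neg hx.le,
      truncInt_symm (a := 1), mul_neg] at h
  have hker : |1 - x⁻¹| ^ (-1 - p * s) = x ^ (1 + p * s) * |1 - x| ^ (-1 - p * s) := by
    rw [show 1 - x⁻¹ = (x - 1) / x by field_simp, abs_div, abs_sub_comm, abs_of_pos hx,
      div_eq_inv_mul, Real.mul_rpow (by positivity) (abs_nonneg _), Real.inv_rpow hx.le,
      ← Real.rpow_neg hx.le]
    ring_nf
  have hexp : x ^ (s - 1) = x ^ (-2 : ℝ) * x ^ (-(s * (p - 1))) * x ^ (1 + p * s) := by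
    rw [← Real.rpow_add hx, ← Real.rpow_add hx]
    ring_nf
  rw [hnum, hker, hexp]
  ring

lemma truncInt_one_of_lt_one (hs : 0 < s) (hp : p ≠ 1) (hl : l ≤ 1) {x : ℝ} (hx0 : 0 < x)
    (hx1 : x < 1) :
    truncInt s p l 1 x = (Iic l).indicator (fun x => (1 - x ^ s) ^ (p - 1)) x := by
  by_cases hxl : x ≤ l
  · rw [truncInt_of_offDiag (Or.inl (by linarith)), indicator_of_mem (by exact hxl),
      posPow_of_nonneg hx0.le, posPow_of_nonneg zero_le_one, Real.one_rpow,
      spow_of_nonneg (sub_ne_zero.2 hp) (sub_nonneg.2 (Real.rpow_le_one hx0.le hx1.le hs.le))]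
  · rw [indicator_of_notMem (by exact hxl), truncInt_of_not_offDiag]
    rintro (h | h)
    · exact hxl (by linarith)
    · nlinarith

/-- The substitution `t ↦ t⁻¹` folds the half line `(1, ∞)` onto `(0, 1)`, where the sum of the two
contributions has an explicit antiderivative; it cancels the contribution of `(-∞, 0]` up to the
boundary term at `l`. -/
lemma integral_truncInt_one (hs0 : 0 < s) (hs1 : s ≤ 1) (hp : 1 < p) (hl0 : 0 ≤ l) (hl1 : l < 1) :
    ∫ t, truncInt s p l 1 t * |1 - t| ^ (-1 - p * s) = truncConst s p l := by
  have hint := integrable_truncInt_mul hs0 hs1 hp hl0 hl1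
  have hfold : ∀ x ∈ Ioo (0 : ℝ) 1, truncInt s p l 1 x * |1 - x| ^ (-1 - p * s) +
      x ^ (-2 : ℝ) • (truncInt s p l 1 x⁻¹ * |1 - x⁻¹| ^ (-1 - p * s)) = (Iic l).indicator
        (fun x => (1 - x ^ s) ^ (p - 1) * (1 - x) ^ (-1 - p * s) * (1 - x ^ (s - 1))) x := by
    intro x hx
    rw [smul_eq_mul, truncInt_one_inv_mul hp.ne' hx.1,
      truncInt_one_of_lt_one hs0 hp.ne' hl1.le hx.1 hx.2, abs_of_pos (sub_pos.2 hx.2)]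
    simp only [indicator_apply]
    split_ifs <;> ring
  have hIoo : Ioo (0 : ℝ) 1 ∩ Iic l = Ioc 0 l := by
    ext x
    exact ⟨fun h => ⟨h.1.1, h.2⟩, fun h => ⟨⟨h.1, h.2.trans_lt hl1⟩, h.2⟩⟩
  rw [← intervalIntegral.integral_Iic_add_Ioi hint.integrableOn hint.integrableOn (b := 0),
    integral_Iic_truncInt_one hs0 hp hl0, integral_Ioi_eq_integral_Ioo_add_inv hint.integrableOn,
    setIntegral_congr_fun measurableSet_Ioo hfold, setIntegral_indicator measurableSet_Iic, hIoo,
    integral_deriv_truncConst hs0 hs1 (by linarith) hl0 hl1, add_sub_cancel]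

lemma integral_truncInt_sub (hs0 : 0 < s) (hs1 : s ≤ 1) (hp : 1 < p) (hl0 : 0 ≤ l)
    (hl1 : l < 1) {a : ℝ} (ha : 0 < a) :
    ∫ t, truncInt s p l a (a - t) * |t| ^ (-1 - p * s) = a ^ (-s) * truncConst s p l := by
  have hscale : ∀ x, truncInt s p l a (a - a * x) * |a * x| ^ (-1 - p * s) =
      a ^ (-1 - s) * (truncInt s p l 1 (1 - x) * |x| ^ (-1 - p * s)) := fun x => by
    have h := truncInt_mul (s := s) (l := l) (a := 1) (b := 1 - x) hp.ne' ha
    rw [mul_one, mul_sub, mul_one] at h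
    rw [h, abs_mul, abs_of_pos ha, Real.mul_rpow ha.le (abs_nonneg _),
      show -1 - s = s * (p - 1) + (-1 - p * s) by ring, Real.rpow_add ha]
    ring
  have h := Measure.integral_comp_mul_left (fun t => truncInt s p l a (a - t) *
    |t| ^ (-1 - p * s)) a
  have htrans := integral_sub_left_eq_self
    (fun t => truncInt s p l 1 t * |1 - t| ^ (-1 - p * s)) volume 1
  simp only [sub_sub_cancel] at htrans
  simp_rw [hscale] at h
  rw [integral_const_mul, htrans, integral_truncInt_one hs0 hs1 hp hl0 hl1, abs_of_pos
    (by positivity), smul_eq_mul, eq_inv_mul_iff_mul_eq₀ ha.ne', ← mul_assoc, mul_comm a,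
    ← Real.rpow_add_one ha.ne'] at h
  rw [← h]
  ring_nf

end OneDimensional

section Slices

/-- The vector with last coordinate `z.1` and remaining coordinates `z.2`. -/
noncomputable def appendCoord {n : ℕ} (z : ℝ × (Fin n → ℝ)) : E (n + 1) :=
  WithLp.toLp 2 ((Fin.last n).insertNth z.1 z.2 : Fin (n + 1) → ℝ)

variable {n : ℕ}

lemma appendCoord_last (z : ℝ × (Fin n → ℝ)) : appendCoord z (Fin.last n) = z.1 := by
  simp [appendCoord]

lemma appendCoord_succAbove (z : ℝ × (Fin n → ℝ)) (j : Fin n) :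
    appendCoord z ((Fin.last n).succAbove j) = z.2 j := by
  simp only [appendCoord, Fin.insertNth_apply_succAbove]

lemma appendCoord_smul (t : ℝ) (z : ℝ × (Fin n → ℝ)) :
    appendCoord (t • z) = t • appendCoord z := by
  ext i
  rcases Fin.eq_self_or_eq_succAbove (Fin.last n) i with rfl | ⟨j, rfl⟩
  · simp only [PiLp.smul_apply, appendCoord_last, Prod.smul_fst]
  · simp only [PiLp.smul_apply, appendCoord_succAbove, Prod.smul_snd, Pi.smul_apply]

lemma measurePreserving_appendCoord (n : ℕ) : MeasurePreserving (appendCoord (n := n)) :=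
  (PiLp.volume_preserving_toLp (Fin (n + 1))).comp
    ((volume_preserving_piFinSuccAbove (fun _ : Fin (n + 1) => ℝ) (Fin.last n)).symm _)

lemma measurableEmbedding_appendCoord (n : ℕ) : MeasurableEmbedding (appendCoord (n := n)) :=
  (MeasurableEquiv.toLp 2 (Fin (n + 1) → ℝ)).measurableEmbedding.comp
    (MeasurableEquiv.piFinSuccAbove (fun _ : Fin (n + 1) => ℝ)
      (Fin.last n)).symm.measurableEmbedding

lemma norm_le_norm_appendCoord (z : ℝ × (Fin n → ℝ)) : ‖z‖ ≤ ‖appendCoord z‖ := by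
  refine max_le ?_ ((pi_norm_le_iff_of_nonneg (norm_nonneg _)).2 fun j => ?_)
  · simpa only [appendCoord_last] using PiLp.norm_apply_le (appendCoord z) (Fin.last n)
  · simpa only [appendCoord_succAbove] using
      PiLp.norm_apply_le (appendCoord z) ((Fin.last n).succAbove j)

lemma one_add_norm_le_two_mul_norm_appendCoord (k : Fin n → ℝ) :
    1 + ‖k‖ ≤ 2 * ‖appendCoord (1, k)‖ := by
  have hk := norm_le_norm_appendCoord (1, k)
  linarith [norm_fst_le ((1 : ℝ), k), norm_snd_le ((1 : ℝ), k), norm_one (α := ℝ)]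

variable {G : Type*} [NormedAddCommGroup G] [NormedSpace ℝ G]

/-- The integral of `‖A x‖ ^ q` over the slice of vectors with last coordinate `1`. -/
noncomputable def sliceConst (A : E (n + 1) →L[ℝ] G) (q : ℝ) : ℝ :=
  ∫ k : Fin n → ℝ, ‖A (appendCoord (1, k))‖ ^ q

lemma integral_slice_norm_rpow (A : E (n + 1) →L[ℝ] G) (q : ℝ) {t : ℝ} (ht : t ≠ 0) :
    ∫ k : Fin n → ℝ, ‖A (appendCoord (t, k))‖ ^ q = |t| ^ (n + q) * sliceConst A q := by
  have hscale : ∀ k : Fin n → ℝ, ‖A (appendCoord (t, t • k))‖ ^ q =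
      |t| ^ q * ‖A (appendCoord (1, k))‖ ^ q := fun k => by
    have htk : (t, t • k) = t • ((1 : ℝ), k) := by simp
    rw [htk, appendCoord_smul, map_smul, norm_smul, Real.norm_eq_abs,
      Real.mul_rpow (abs_nonneg _) (norm_nonneg _)]
  have ht' : 0 < |t| := abs_pos.2 ht
  have hcomp := Measure.integral_comp_smul volume
    (fun k : Fin n → ℝ => ‖A (appendCoord (t, k))‖ ^ q) t
  simp_rw [hscale] at hcomp
  rw [integral_const_mul, finrank_fin_fun, abs_inv, abs_pow, smul_eq_mul,
    eq_inv_mul_iff_mul_eq₀ (by positivity)] at hcomp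
  rw [← hcomp, Real.rpow_add ht', Real.rpow_natCast, sliceConst, mul_assoc]

lemma sliceConst_nonneg (A : E (n + 1) →L[ℝ] G) (q : ℝ) : 0 ≤ sliceConst A q :=
  integral_nonneg fun _ => by positivity

lemma sliceConst_neg_le {A : E (n + 1) →L[ℝ] G} {c q : ℝ} (hc : 0 < c)
    (hA : ∀ h, c * ‖h‖ ≤ ‖A h‖) (hq : n < q) :
    sliceConst A (-q) ≤ ∫ k : Fin n → ℝ, (c / 2) ^ (-q) * (1 + ‖k‖) ^ (-q) := by
  refine integral_mono_of_nonneg (Eventually.of_forall fun k => by positivity)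
    ((integrable_one_add_norm (by simpa using hq)).const_mul _) (Eventually.of_forall fun k => ?_)
  have hk : c / 2 * (1 + ‖k‖) ≤ ‖A (appendCoord (1, k))‖ := by
    nlinarith [one_add_norm_le_two_mul_norm_appendCoord k, hA (appendCoord (1, k))]
  simp only
  rw [← Real.mul_rpow (by positivity) (by positivity)]
  exact Real.rpow_le_rpow_of_nonpos (by positivity) hk
    (neg_nonpos.2 ((Nat.cast_nonneg n).trans hq.le))

lemma integral_last_mul_norm_rpow {A : E (n + 1) →L[ℝ] G} {q : ℝ} {g : ℝ → ℝ}
    (hg : Integrable fun h : E (n + 1) => g (h (Fin.last n)) * ‖A h‖ ^ q) :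
    ∫ h : E (n + 1), g (h (Fin.last n)) * ‖A h‖ ^ q =
      sliceConst A q * ∫ t, g t * |t| ^ (n + q) := by
  have hmp := measurePreserving_appendCoord n
  have hme := measurableEmbedding_appendCoord n
  rw [← hmp.integrable_comp_emb hme, Measure.volume_eq_prod] at hg
  rw [← hmp.integral_comp hme, Measure.volume_eq_prod, ← integral_const_mul]
  refine (integral_prod _ hg).trans (integral_congr_ae ?_)
  filter_upwards [compl_mem_ae_iff.2 (measure_singleton (0 : ℝ))] with t ht
  simp only [Function.comp_def, appendCoord_last]
  rw [integral_const_mul, integral_slice_norm_rpow A q ht, ← mul_assoc, mul_comm]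

lemma exists_integral_lastCoord_mul_norm_rpow {N : ℕ} (hN : 1 ≤ N) {b c : ℝ} (hb : 0 < b)
    (hc : 0 < c) :
    ∃ B : ℝ, 0 ≤ B ∧ ∀ A : E N →L[ℝ] G, (∀ h, c * ‖h‖ ≤ ‖A h‖) → ∃ cA : ℝ, |cA| ≤ B ∧
      ∀ g : ℝ → ℝ, Integrable (fun h => g (lastCoord hN h) * ‖A h‖ ^ (-(N : ℝ) - b)) →
        ∫ h, g (lastCoord hN h) * ‖A h‖ ^ (-(N : ℝ) - b) = cA * ∫ t, g t * |t| ^ (-1 - b) := by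
  obtain ⟨n, rfl⟩ : ∃ n, N = n + 1 := ⟨N - 1, by omega⟩
  have hq : (n : ℝ) < (n + 1 : ℕ) + b := by
    push_cast
    linarith
  have hexp : (n : ℝ) + -((n + 1 : ℕ) + b) = -1 - b := by
    push_cast
    ring
  rw [← neg_add']
  refine ⟨_, integral_nonneg fun k => by positivity, fun A hA =>
    ⟨sliceConst A _, (abs_of_nonneg (sliceConst_nonneg A _)).trans_le
      (sliceConst_neg_le hc hA hq), fun g hg => ?_⟩⟩
  rw [← hexp]
  exact integral_last_mul_norm_rpow hg

lemma lintegral_ball_abs_lastCoord_rpow_lt_top {N : ℕ} (hN : 1 ≤ N) {b : ℝ} (hb : -1 < b)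
    (R : ℝ) :
    ∫⁻ x in Metric.ball (0 : E N) R, ENNReal.ofReal (|lastCoord hN x| ^ b) < ∞ := by
  obtain ⟨n, rfl⟩ : ∃ n, N = n + 1 := ⟨N - 1, by omega⟩
  have hmp := measurePreserving_appendCoord n
  have hme := measurableEmbedding_appendCoord n
  have hcube : appendCoord ⁻¹' Metric.ball (0 : E (n + 1)) R ⊆
      Metric.ball 0 R ×ˢ Metric.ball 0 R := by
    rw [ball_prod_same]
    exact fun z hz => mem_ball_zero_iff.2
      ((norm_le_norm_appendCoord z).trans_lt (mem_ball_zero_iff.1 hz))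
  have hint : IntegrableOn (fun t : ℝ => |t| ^ b) (Metric.ball 0 R) := by
    classical
    have h := integrable_indicator_Iio_norm_rpow (F := ℝ) volume (b := b + 1) (by linarith) R
    refine (integrable_indicator_iff measurableSet_ball).1
      (h.congr (Eventually.of_forall fun t => ?_))
    simp only [indicator_apply, mem_Iio, mem_ball_zero_iff, finrank_self, Nat.cast_one,
      neg_add_cancel_comm_assoc, Real.norm_eq_abs]
  rw [← hmp.setLIntegral_comp_preimage_emb hme]
  refine (lintegral_mono_set hcube).trans_lt ?_
  rw [Measure.volume_eq_prod, ← Measure.prod_restrict]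
  have hlast : ∀ z : ℝ × (Fin n → ℝ), lastCoord hN (appendCoord z) = z.1 := appendCoord_last
  simp only [hlast]
  rw [lintegral_prod _ (by fun_prop)]
  simp only [lintegral_const]
  rw [lintegral_mul_const _ (by fun_prop), Measure.restrict_apply_univ]
  exact ENNReal.mul_lt_top hint.lintegral_lt_top measure_ball_lt_top

end Slices

section LastCoord

variable {N : ℕ}

lemma abs_lastCoord_sub_le (hN : 1 ≤ N) (x y : E N) :
    |lastCoord hN x - lastCoord hN y| ≤ ‖x - y‖ :=
  PiLp.norm_apply_le (x - y) _

lemma lipschitzWith_lastCoord (hN : 1 ≤ N) : LipschitzWith 1 (lastCoord hN) :=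
  LipschitzWith.of_dist_le_mul fun x y => by
    simpa [dist_eq_norm] using abs_lastCoord_sub_le hN x y

lemma continuous_lastCoord (hN : 1 ≤ N) : Continuous (lastCoord hN) :=
  (lipschitzWith_lastCoord hN).continuous

lemma nontrivial_E (hN : 1 ≤ N) : Nontrivial (E N) :=
  have : Nonempty (Fin N) := ⟨⟨0, hN⟩⟩
  inferInstance

end LastCoord

section Lipschitz

variable {F G : Type*} [NormedAddCommGroup F] [NormedSpace ℝ F] [NormedAddCommGroup G]
  [NormedSpace ℝ G] {g : F → G} {L : ℝ≥0} {K : ℝ}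

lemma norm_sub_le_of_ae_norm_fderiv_segment_le (hg : LipschitzWith L g) {z v : F}
    (hK : ∀ᵐ t : ℝ, DifferentiableAt ℝ g (z + t • v) ∧ ‖fderiv ℝ g (z + t • v)‖ ≤ K) :
    ‖g (z + v) - g z‖ ≤ K * ‖v‖ := by
  obtain ⟨ℓ, hℓ_norm, hℓ⟩ := exists_dual_vector'' ℝ (g (z + v) - g z)
  set φ : ℝ → ℝ := fun t => ℓ (g (z + t • v)) with hφ
  have hφ_lip : LipschitzWith (‖ℓ‖₊ * (L * ‖v‖₊)) φ := by
    refine ℓ.lipschitz.comp (hg.comp (LipschitzWith.of_dist_le_mul fun a b => ?_))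
    rw [dist_add_left, dist_eq_norm, ← sub_smul, norm_smul, coe_nnnorm, mul_comm, dist_eq_norm]
  have hφ_deriv : ∀ᵐ t : ℝ, ‖deriv φ t‖ ≤ K * ‖v‖ := by
    filter_upwards [hK] with t ⟨hdiff, hle⟩
    have hline : HasDerivAt (fun t : ℝ => z + t • v) v t := by
      simpa using ((hasDerivAt_id t).smul_const v).const_add z
    have hderiv : deriv φ t = ℓ (fderiv ℝ g (z + t • v) v) :=
      (ℓ.hasFDerivAt.comp_hasDerivAt t (hdiff.hasFDerivAt.comp_hasDerivAt t hline)).deriv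
    calc ‖deriv φ t‖ ≤ 1 * ‖fderiv ℝ g (z + t • v) v‖ := by
          rw [hderiv]
          exact ℓ.le_of_opNorm_le hℓ_norm _
      _ ≤ K * ‖v‖ := by
          rw [one_mul]
          exact ContinuousLinearMap.le_of_opNorm_le _ hle _
  have hFTC := (hφ_lip.lipschitzOnWith (s := uIcc 0 1)).absolutelyContinuousOnInterval
    |>.integral_deriv_eq_sub
  have hle := intervalIntegral.norm_integral_le_of_norm_le_const_ae (a := 0) (b := 1)
    (hφ_deriv.mono fun t ht _ => ht)
  rw [hFTC] at hle
  simp only [hφ, one_smul, zero_smul, add_zero, sub_zero, abs_one, mul_one] at hle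
  rw [← map_sub, hℓ] at hle
  simpa using hle

variable [FiniteDimensional ℝ F] [MeasurableSpace F] [BorelSpace F] {μ : Measure F}
  [μ.IsAddHaarMeasure]

lemma ae_ae_add_smul {P : F → Prop} (hP : ∀ᵐ z ∂μ, P z) (v : F) :
    ∀ᵐ z ∂μ, ∀ᵐ t : ℝ, P (z + t • v) := by
  obtain ⟨T, hPT, hT, hT0⟩ := exists_measurable_superset_of_null (ae_iff.1 hP)
  have hTc : ∀ᵐ z ∂μ, ∀ᵐ t : ℝ, z + t • v ∈ Tᶜ := by
    rw [Measure.ae_ae_comm]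
    · exact Eventually.of_forall fun t =>
        (measurePreserving_add_right μ (t • v)).quasiMeasurePreserving.ae (compl_mem_ae_iff.2 hT0)
    · exact (show Measurable fun q : F × ℝ => q.1 + q.2 • v by fun_prop) hT.compl
  exact hTc.mono fun z hz => hz.mono fun t ht => not_not.1 (mt (@hPT _) ht)

lemma norm_sub_le_of_ae_norm_fderiv_le [FiniteDimensional ℝ G] (hg : LipschitzWith L g)
    (hK : ∀ᵐ x ∂μ, ‖fderiv ℝ g x‖ ≤ K) (x y : F) : ‖g x - g y‖ ≤ K * ‖x - y‖ := by
  have hae : ∀ᵐ z ∂μ, ‖g (z + (x - y)) - g z‖ ≤ K * ‖x - y‖ := by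
    filter_upwards [ae_ae_add_smul (hg.ae_differentiableAt.and hK) (x - y)] with z hz
    exact norm_sub_le_of_ae_norm_fderiv_segment_le hg hz
  have hclosed : IsClosed {z | ‖g (z + (x - y)) - g z‖ ≤ K * ‖x - y‖} := by
    have := hg.continuous
    exact isClosed_le (by fun_prop) continuous_const
  have huniv := hclosed.closure_eq.symm.trans (Measure.dense_of_ae hae).closure_eq
  simpa using huniv.ge (mem_univ y)

end Lipschitz

section Convolution

variable {F : Type*} [NormedAddCommGroup F] [MeasurableSpace F] [BorelSpace F]
  [SecondCountableTopology F] {μ : Measure F} [SFinite μ] [μ.IsAddRightInvariant]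
  {f : F → ℝ} {k : ℝ → ℝ}

lemma integrable_snd_mul_comp_norm_sub (hf : Integrable f μ)
    (hk : Integrable (fun h => k ‖h‖) μ) :
    Integrable (fun z : F × F => f z.2 * k ‖z.1 - z.2‖) (μ.prod μ) := by
  simpa using hf.convolution_integrand (ContinuousLinearMap.mul ℝ ℝ) hk

lemma integrable_fst_mul_comp_norm_sub (hf : Integrable f μ)
    (hk : Integrable (fun h => k ‖h‖) μ) :
    Integrable (fun z : F × F => f z.1 * k ‖z.1 - z.2‖) (μ.prod μ) := by
  simpa [Function.comp_def, norm_sub_rev] using (integrable_snd_mul_comp_norm_sub hf hk).swap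

end Convolution

section Gagliardo

variable {N : ℕ} {s p : ℝ} {u : E N → ℝ}

lemma rpow_mul_rpow_neg_sub {d : ℝ} (N : ℕ) (s p : ℝ) (hd : 0 < d) :
    d ^ (s * (p - 1)) * d ^ (-(N : ℝ) - p * s) = d ^ (-(N : ℝ) - s) := by
  rw [← Real.rpow_add hd]
  ring_nf

lemma gagliardo_nonneg (s p : ℝ) (u : E N → ℝ) (z : E N × E N) : 0 ≤ gagliardo s p u z := by
  unfold gagliardo
  positivity

lemma aestronglyMeasurable_gagliardo (s p : ℝ) (hu : AEStronglyMeasurable u volume) :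
    AEStronglyMeasurable (gagliardo s p u) volume := by
  have hfst : AEMeasurable (fun z : E N × E N => u z.1) := hu.comp_fst.aemeasurable
  have hsnd : AEMeasurable (fun z : E N × E N => u z.2) := hu.comp_snd.aemeasurable
  unfold gagliardo
  exact (((hfst.sub hsnd).abs.pow_const p).div (by fun_prop)).aestronglyMeasurable

/-- The powers of `‖x - y‖` leave the integrable singularity `‖x - y‖ ^ (-N + (1 - s))`, at the
price of the weight `|a| ^ (s - 1)`. -/
lemma gagliardo_posPow_comp_le (hs0 : 0 < s) (hs1 : s ≤ 1) (hp : 1 ≤ p) {a : E N → ℝ} {Λ : ℝ≥0}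
    (ha : LipschitzWith Λ a) (z : E N × E N) :
    gagliardo s p (fun x => posPow s (a x)) z ≤ Λ ^ (s * p + (1 - s)) *
      (|a z.1| ^ (s - 1) * ‖z.1 - z.2‖ ^ (-(N : ℝ) + (1 - s)) +
        |a z.2| ^ (s - 1) * ‖z.1 - z.2‖ ^ (-(N : ℝ) + (1 - s))) := by
  obtain ⟨x, y⟩ := z
  rcases eq_or_ne x y with rfl | hxy
  · have h0 : gagliardo s p (fun x => posPow s (a x)) (x, x) = 0 := by
      simp [gagliardo, Real.zero_rpow (one_pos.trans_le hp).ne']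
    rw [h0]
    positivity
  have hpos : 0 < ‖x - y‖ := norm_sub_pos_iff.2 hxy
  have : 0 ≤ s * p + (1 - s) := by nlinarith
  have hsplit : ‖x - y‖ ^ (s * p + (1 - s)) =
      ‖x - y‖ ^ (-(N : ℝ) + (1 - s)) * ‖x - y‖ ^ ((N : ℝ) + p * s) := by
    rw [← Real.rpow_add hpos]
    ring_nf
  unfold gagliardo
  rw [div_le_iff₀ (by positivity)]
  calc |posPow s (a x) - posPow s (a y)| ^ p
      ≤ |a x - a y| ^ (s * p + (1 - s)) * (|a x| ^ (s - 1) + |a y| ^ (s - 1)) :=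
        abs_posPow_sub_rpow_le hs0 hs1 hp _ _
    _ ≤ (Λ * ‖x - y‖) ^ (s * p + (1 - s)) * (|a x| ^ (s - 1) + |a y| ^ (s - 1)) := by
        gcongr
        exact ha.norm_sub_le x y
    _ = _ := by
        rw [Real.mul_rpow Λ.coe_nonneg hpos.le, hsplit]
        ring

lemma integrableOn_gagliardo_posPow_comp [Nontrivial (E N)] (hs0 : 0 < s) (hs1 : s < 1)
    (hp : 1 ≤ p) {a : E N → ℝ} {Λ : ℝ≥0} (ha : LipschitzWith Λ a) {R : ℝ}
    (hint : IntegrableOn (fun x => |a x| ^ (s - 1)) (Metric.ball 0 R)) :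
    IntegrableOn (gagliardo s p fun x => posPow s (a x)) (Metric.ball 0 R ×ˢ Metric.ball 0 R) := by
  set B : Set (E N) := Metric.ball 0 R
  have hker := integrable_indicator_Iio_norm_rpow (F := E N) volume (sub_pos.2 hs1) (2 * R)
  rw [finrank_euclideanSpace_fin] at hker
  have hind := (integrable_indicator_iff measurableSet_ball).2 hint
  have hdom := ((integrable_fst_mul_comp_norm_sub hind hker).add
    (integrable_snd_mul_comp_norm_sub hind hker)).const_mul (Λ ^ (s * p + (1 - s)) : ℝ)
  refine Integrable.mono' hdom.integrableOn (aestronglyMeasurable_gagliardo s p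
    ((continuous_posPow hs0.le).comp ha.continuous).aestronglyMeasurable).restrict ?_
  filter_upwards [ae_restrict_mem (measurableSet_ball.prod measurableSet_ball)] with z ⟨hz1, hz2⟩
  have hlt : ‖z.1 - z.2‖ < 2 * R := by
    linarith [norm_sub_le z.1 z.2, mem_ball_zero_iff.1 hz1, mem_ball_zero_iff.1 hz2]
  rw [Real.norm_of_nonneg (gagliardo_nonneg _ _ _ _), Pi.add_apply, indicator_of_mem hz1,
    indicator_of_mem hz2, indicator_of_mem (by exact hlt)]
  exact gagliardo_posPow_comp_le hs0 hs1.le hp ha z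

lemma abs_posPow_comp_sub_le (hs0 : 0 ≤ s) (hs1 : s ≤ 1) {a : E N → ℝ} {Λ : ℝ≥0}
    (ha : LipschitzWith Λ a) (x y : E N) :
    |posPow s (a x) - posPow s (a y)| ≤ Λ ^ s * ‖x - y‖ ^ s := by
  rw [← Real.mul_rpow Λ.coe_nonneg (norm_nonneg _)]
  exact (abs_posPow_sub_le hs0 hs1 _ _).trans
    (Real.rpow_le_rpow (abs_nonneg _) (ha.norm_sub_le x y) hs0)

end Gagliardo

section TildeSpace

variable {N : ℕ} {s p : ℝ} {u : E N → ℝ}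

lemma memLpLoc_of_continuous (p : ℝ) (hu : Continuous u) : MemLpLoc p u := fun S hS => by
  obtain ⟨C, hC⟩ := hS.exists_bound_of_continuousOn hu.continuousOn
  have : IsFiniteMeasure (volume.restrict S) := ⟨by simpa using hS.measure_lt_top⟩
  refine MemLp.of_bound hu.aestronglyMeasurable C ?_
  filter_upwards [ae_restrict_mem hS.measurableSet] with x hx using hC x hx

lemma lintegral_tail_lt_top (hs : 0 < s) (hp : 1 ≤ p) {C : ℝ}
    (hu : ∀ x, |u x| ≤ C * (1 + ‖x‖) ^ s) :
    ∫⁻ x : E N, ENNReal.ofReal (|u x| ^ (p - 1) / (1 + ‖x‖) ^ ((N : ℝ) + p * s)) < ∞ := by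
  have hC : 0 ≤ C := by simpa using (abs_nonneg _).trans (hu 0)
  have htail := integrable_one_add_norm (E := E N) (μ := volume) (r := (N : ℝ) + s)
    (by simpa using hs)
  refine lt_of_le_of_lt (lintegral_mono fun x => ENNReal.ofReal_le_ofReal ?_)
    (htail.const_mul (C ^ (p - 1))).lintegral_lt_top
  have hpos : 0 < 1 + ‖x‖ := by positivity
  rw [div_le_iff₀ (by positivity)]
  calc |u x| ^ (p - 1) ≤ (C * (1 + ‖x‖) ^ s) ^ (p - 1) := by
        gcongr
        exact hu x
    _ = C ^ (p - 1) * (1 + ‖x‖) ^ (s * (p - 1)) := by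
        rw [Real.mul_rpow hC (by positivity), ← Real.rpow_mul hpos.le]
    _ = C ^ (p - 1) * (1 + ‖x‖) ^ (-((N : ℝ) + s)) * (1 + ‖x‖) ^ ((N : ℝ) + p * s) := by
        rw [mul_assoc, ← Real.rpow_add hpos]
        ring_nf

lemma memWTilde_of_continuous (hs : 0 < s) (hp : 1 ≤ p) (hu : Continuous u) {C : ℝ}
    (hgrowth : ∀ x, |u x| ≤ C * (1 + ‖x‖) ^ s)
    (hgag : ∀ R, IntegrableOn (gagliardo s p u) (Metric.ball 0 R ×ˢ Metric.ball 0 R))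
    {Ω : Set (E N)} (hΩ : Bornology.IsBounded Ω) : MemWTilde s p Ω u := by
  have hloc := memLpLoc_of_continuous p hu
  obtain ⟨R, hR⟩ := hΩ.subset_closedBall 0
  refine ⟨hloc, Metric.ball 0 (R + 1), Metric.isOpen_ball,
    (closure_minimal hR Metric.isClosed_closedBall).trans
      (Metric.closedBall_subset_ball (lt_add_one R)),
    ENNReal.add_lt_top.2 ⟨ENNReal.add_lt_top.2 ⟨?_, ?_⟩, lintegral_tail_lt_top hs hp hgrowth⟩⟩
  · exact ((hloc _ (isCompact_closedBall 0 (R + 1))).mono_measure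
      (Measure.restrict_mono Metric.ball_subset_closedBall le_rfl)).eLpNorm_lt_top
  · exact ENNReal.rpow_lt_top_of_nonneg (by positivity) (hgag (R + 1)).lintegral_lt_top.ne

lemma exists_abs_posPow_comp_le (hs : 0 ≤ s) {a : E N → ℝ} {Λ : ℝ≥0} (ha : LipschitzWith Λ a) :
    ∃ C, ∀ x, |posPow s (a x)| ≤ C * (1 + ‖x‖) ^ s := by
  refine ⟨(|a 0| + Λ) ^ s, fun x => ?_⟩
  have hx : |a x| ≤ (|a 0| + Λ) * (1 + ‖x‖) := by
    have h0 := ha.norm_sub_le x 0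
    rw [sub_zero, Real.norm_eq_abs] at h0
    nlinarith [abs_sub_abs_le_abs_sub (a x) (a 0), abs_nonneg (a 0), norm_nonneg x, Λ.2]
  rw [← Real.mul_rpow (by positivity) (by positivity), posPow, abs_of_nonneg (by positivity)]
  exact Real.rpow_le_rpow (le_max_right _ _) ((max_le (le_abs_self _) (abs_nonneg _)).trans hx) hs

end TildeSpace

namespace MemW0

variable {N : ℕ} {s p : ℝ} {Ω : Set (E N)} {φ : E N → ℝ}

lemma memLp (h : MemW0 s p Ω φ) : MemLp φ (ENNReal.ofReal p) :=
  ⟨h.1, by simpa using (ENNReal.add_lt_top.1 h.2.1).1⟩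

lemma integrable_gagliardo (h : MemW0 s p Ω φ) (hp : 0 < p) : Integrable (gagliardo s p φ) := by
  have hfin := (ENNReal.add_lt_top.1 h.2.1).2
  rw [ENNReal.rpow_lt_top_iff_of_pos (by positivity), univ_prod_univ,
    Measure.restrict_univ] at hfin
  refine ⟨aestronglyMeasurable_gagliardo s p h.1, ?_⟩
  rwa [hasFiniteIntegral_iff_ofReal (Eventually.of_forall fun z => gagliardo_nonneg _ _ _ _)]

lemma integrableOn (h : MemW0 s p Ω φ) (hp : 1 ≤ p) {S : Set (E N)}
    (hS : Bornology.IsBounded S) : IntegrableOn φ S := by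
  have : IsFiniteMeasure (volume.restrict S) := ⟨by simpa using hS.measure_lt_top⟩
  exact (h.memLp.restrict S).integrable (ENNReal.one_le_ofReal.2 hp)

lemma integrable (h : MemW0 s p Ω φ) (hp : 1 ≤ p) (hΩ : Bornology.IsBounded Ω) :
    Integrable φ := by
  obtain ⟨R, hR⟩ := hΩ.subset_closedBall 0
  have hind := (integrable_indicator_iff Metric.isClosed_closedBall.measurableSet).2
    (h.integrableOn hp (Metric.isBounded_closedBall (x := (0 : E N)) (r := R)))
  refine hind.congr ?_
  filter_upwards [h.2.2] with x hx
  by_cases hxR : x ∈ Metric.closedBall (0 : E N) R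
  · rw [indicator_of_mem hxR]
  · rw [indicator_of_notMem hxR, hx fun hxΩ => hxR (hR hxΩ)]

lemma ae_prod (h : MemW0 s p Ω φ) :
    ∀ᵐ z : E N × E N, (z.1 ∉ Ω → φ z.1 = 0) ∧ (z.2 ∉ Ω → φ z.2 = 0) := by
  rw [Measure.volume_eq_prod]
  exact (Measure.quasiMeasurePreserving_fst.ae h.2.2).and
    (Measure.quasiMeasurePreserving_snd.ae h.2.2)

end MemW0

section Dual

variable {N : ℕ} {s p : ℝ} {Ω : Set (E N)}

lemma eLpNorm_le_wNorm (s p : ℝ) (U : Set (E N)) (φ : E N → ℝ) :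
    eLpNorm φ (ENNReal.ofReal p) (volume.restrict U) ≤ wNorm s p univ φ :=
  (eLpNorm_mono_measure _ (Measure.restrict_mono (subset_univ _) le_rfl)).trans le_self_add

lemma memDual_of_bounded (hp : 1 ≤ p) (hΩ : Bornology.IsBounded Ω) {f : E N → ℝ}
    (hf : AEStronglyMeasurable f (volume.restrict Ω)) {C : ℝ≥0} (hC : ∀ x, |f x| ≤ C) :
    MemDual s p Ω f := by
  have : IsFiniteMeasure (volume.restrict Ω) := ⟨by simpa using hΩ.measure_lt_top⟩
  have hp' : 1 ≤ ENNReal.ofReal p := ENNReal.one_le_ofReal.2 hp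
  refine ⟨fun φ hφ => (hφ.integrableOn hp hΩ).bdd_mul hf (Eventually.of_forall hC), ?_⟩
  set V : ℝ≥0∞ := (volume.restrict Ω) univ ^
    (1 / (1 : ℝ≥0∞).toReal - 1 / (ENNReal.ofReal p).toReal)
  have hV : V ≠ ∞ := by
    refine ENNReal.rpow_ne_top_of_nonneg ?_ (measure_ne_top _ _)
    rw [ENNReal.toReal_one, ENNReal.toReal_ofReal (zero_le_one.trans hp), sub_nonneg]
    gcongr
  refine ⟨C * V.toNNReal, fun φ hφ => ?_⟩
  calc ‖∫ x in Ω, f x * φ x‖ₑ ≤ ∫⁻ x in Ω, ‖f x * φ x‖ₑ := enorm_integral_le_lintegral_enorm _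
    _ ≤ ∫⁻ x in Ω, C * ‖φ x‖ₑ := by
      refine lintegral_mono fun x => ?_
      rw [enorm_mul]
      gcongr
      exact enorm_le_coe.2 (hC x)
    _ = C * eLpNorm φ 1 (volume.restrict Ω) := by
      rw [lintegral_const_mul' _ _ ENNReal.coe_ne_top, eLpNorm_one_eq_lintegral_enorm]
    _ ≤ C * (eLpNorm φ (ENNReal.ofReal p) (volume.restrict Ω) * V) := by
      gcongr
      exact eLpNorm_le_eLpNorm_mul_rpow_measure_univ hp' hφ.1.restrict
    _ ≤ C * (wNorm s p univ φ * V) := by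
      gcongr
      exact eLpNorm_le_wNorm s p Ω φ
    _ = ↑(C * V.toNNReal) * wNorm s p univ φ := by
      rw [ENNReal.coe_mul, ENNReal.coe_toNNReal hV]
      ring

end Dual

section WeakForm

variable {N : ℕ} {s p : ℝ} {Ω : Set (E N)} {u φ : E N → ℝ}

lemma aestronglyMeasurable_weakForm (s p : ℝ) (hu : AEStronglyMeasurable u volume)
    (hφ : AEStronglyMeasurable φ volume) : AEStronglyMeasurable (weakForm s p u φ) volume := by
  have hdiff : ∀ {g : E N → ℝ}, AEStronglyMeasurable g volume →
      AEMeasurable (fun z : E N × E N => g z.1 - g z.2) volume :=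
    fun h => h.comp_fst.aemeasurable.sub h.comp_snd.aemeasurable
  unfold weakForm
  exact ((((measurable_spow (p - 1)).comp_aemeasurable (hdiff hu)).mul (hdiff hφ)).div
    (by fun_prop)).aestronglyMeasurable

lemma abs_weakForm (hp : p ≠ 1) (u φ : E N → ℝ) (z : E N × E N) :
    |weakForm s p u φ z| =
      |u z.1 - u z.2| ^ (p - 1) * |φ z.1 - φ z.2| * ‖z.1 - z.2‖ ^ (-(N : ℝ) - p * s) := by
  have hd : 0 ≤ ‖z.1 - z.2‖ ^ ((N : ℝ) + p * s) := by positivity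
  unfold weakForm
  rw [abs_div, abs_mul, abs_spow (sub_ne_zero.2 hp), abs_of_nonneg hd, div_eq_mul_inv,
    ← Real.rpow_neg (norm_nonneg _), neg_add']

lemma rpow_sub_one_mul_le_add (hp : 1 ≤ p) {a b : ℝ} (ha : 0 ≤ a) (hb : 0 ≤ b) :
    a ^ (p - 1) * b ≤ a ^ p + b ^ p := by
  have hsplit : ∀ {c : ℝ}, 0 ≤ c → c ^ (p - 1) * c = c ^ p := fun hc => by
    rw [← Real.rpow_add_one' hc (by linarith), sub_add_cancel]
  rcases le_total a b with h | h
  · calc a ^ (p - 1) * b ≤ b ^ (p - 1) * b := by gcongr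
      _ ≤ a ^ p + b ^ p := by rw [hsplit hb]; linarith [Real.rpow_nonneg ha p]
  · calc a ^ (p - 1) * b ≤ a ^ (p - 1) * a := by gcongr
      _ ≤ a ^ p + b ^ p := by rw [hsplit ha]; linarith [Real.rpow_nonneg hb p]

lemma abs_weakForm_le_gagliardo (hp : 1 < p) (u φ : E N → ℝ) (z : E N × E N) :
    |weakForm s p u φ z| ≤ gagliardo s p u z + gagliardo s p φ z := by
  rw [abs_weakForm hp.ne', gagliardo, gagliardo, ← add_div, div_eq_mul_inv _ (_ ^ _),
    ← Real.rpow_neg (norm_nonneg _), neg_add']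
  gcongr
  exact rpow_sub_one_mul_le_add hp.le (abs_nonneg _) (abs_nonneg _)

lemma abs_weakForm_le_of_holder (hp : 1 < p) {C : ℝ} (hC : 0 ≤ C)
    (hu : ∀ x y, |u x - u y| ≤ C * ‖x - y‖ ^ s) {z : E N × E N} (hz : 0 < ‖z.1 - z.2‖) :
    |weakForm s p u φ z| ≤
      C ^ (p - 1) * ((|φ z.1| + |φ z.2|) * ‖z.1 - z.2‖ ^ (-(N : ℝ) - s)) := by
  rw [abs_weakForm hp.ne']
  calc |u z.1 - u z.2| ^ (p - 1) * |φ z.1 - φ z.2| * ‖z.1 - z.2‖ ^ (-(N : ℝ) - p * s)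
      ≤ (C * ‖z.1 - z.2‖ ^ s) ^ (p - 1) * (|φ z.1| + |φ z.2|) *
          ‖z.1 - z.2‖ ^ (-(N : ℝ) - p * s) := by
        gcongr
        exacts [hu _ _, abs_sub _ _]
    _ = C ^ (p - 1) * ((|φ z.1| + |φ z.2|) * (‖z.1 - z.2‖ ^ (s * (p - 1)) *
          ‖z.1 - z.2‖ ^ (-(N : ℝ) - p * s))) := by
        rw [Real.mul_rpow hC (by positivity), ← Real.rpow_mul hz.le]
        ring
    _ = _ := by rw [rpow_mul_rpow_neg_sub N s p hz]

lemma weakForm_eq_zero_or_mem_ball_prod {R : ℝ} (hΩ : Ω ⊆ Metric.ball 0 R) {z : E N × E N}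
    (hφ₁ : z.1 ∉ Ω → φ z.1 = 0) (hφ₂ : z.2 ∉ Ω → φ z.2 = 0) (hz : ‖z.1 - z.2‖ < 1) :
    weakForm s p u φ z = 0 ∨ z ∈ Metric.ball 0 (R + 1) ×ˢ Metric.ball 0 (R + 1) := by
  have hball : ∀ x ∈ Ω, ∀ y, ‖x - y‖ < 1 →
      x ∈ Metric.ball (0 : E N) (R + 1) ∧ y ∈ Metric.ball (0 : E N) (R + 1) := by
    intro x hx y hxy
    have hxR : ‖x‖ < R := mem_ball_zero_iff.1 (hΩ hx)
    rw [mem_ball_zero_iff, mem_ball_zero_iff]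
    exact ⟨by linarith, by linarith [norm_le_norm_add_norm_sub x y]⟩
  by_cases h₁ : z.1 ∈ Ω
  · exact Or.inr (hball _ h₁ _ hz)
  by_cases h₂ : z.2 ∈ Ω
  · exact Or.inr (hball _ h₂ _ (norm_sub_rev z.1 z.2 ▸ hz)).symm
  · exact Or.inl (by simp [weakForm, hφ₁ h₁, hφ₂ h₂])

lemma MemW0.integrable_weakForm [Nontrivial (E N)] (hφ : MemW0 s p Ω φ) (hs : 0 < s) (hp : 1 < p)
    (hΩ : Bornology.IsBounded Ω) (hu : AEStronglyMeasurable u volume) {C : ℝ} (hC : 0 ≤ C)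
    (hholder : ∀ x y, |u x - u y| ≤ C * ‖x - y‖ ^ s)
    (hgag : ∀ R, IntegrableOn (gagliardo s p u) (Metric.ball 0 R ×ˢ Metric.ball 0 R)) :
    Integrable (weakForm s p u φ) := by
  obtain ⟨R, hR⟩ := hΩ.subset_ball 0
  set B : Set (E N × E N) := Metric.ball 0 (R + 1) ×ˢ Metric.ball 0 (R + 1)
  set k : ℝ → ℝ := (Ici 1).indicator fun d => d ^ (-(N : ℝ) - s)
  have hk : Integrable fun h : E N => k ‖h‖ := by
    simpa [finrank_euclideanSpace_fin] using
      integrable_indicator_Ici_norm_rpow (F := E N) volume hs one_pos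
  have hφi := (hφ.integrable hp.le hΩ).abs
  have hnear := (integrable_indicator_iff (measurableSet_ball.prod measurableSet_ball)).2
    (hgag (R + 1))
  have hfar := ((integrable_fst_mul_comp_norm_sub hφi hk).add
    (integrable_snd_mul_comp_norm_sub hφi hk)).const_mul (C ^ (p - 1))
  refine ((hnear.add (hφ.integrable_gagliardo (one_pos.trans hp))).add hfar).mono'
    (aestronglyMeasurable_weakForm s p hu hφ.1) ?_
  filter_upwards [hφ.ae_prod] with z hz
  have hk0 : 0 ≤ k ‖z.1 - z.2‖ := indicator_apply_nonneg fun _ => by positivity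
  have hφ0 : 0 ≤ gagliardo s p φ z := gagliardo_nonneg _ _ _ _
  have hu0 : 0 ≤ B.indicator (gagliardo s p u) z :=
    indicator_apply_nonneg fun _ => gagliardo_nonneg _ _ _ _
  simp only [Pi.add_apply, Real.norm_eq_abs, ← add_mul]
  rcases le_or_gt 1 ‖z.1 - z.2‖ with hfar | hnear
  · have hle := abs_weakForm_le_of_holder (φ := φ) hp hC hholder (one_pos.trans_le hfar)
    have hkz : k ‖z.1 - z.2‖ = ‖z.1 - z.2‖ ^ (-(N : ℝ) - s) := indicator_of_mem (by exact hfar) _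
    rw [hkz]
    linarith
  · have hfar0 : 0 ≤ C ^ (p - 1) * ((|φ z.1| + |φ z.2|) * k ‖z.1 - z.2‖) := by positivity
    rcases weakForm_eq_zero_or_mem_ball_prod hR hz.1 hz.2 hnear with h0 | hzB
    · rw [h0, abs_zero]
      positivity
    · rw [indicator_of_mem hzB]
      linarith [abs_weakForm_le_gagliardo (s := s) hp u φ z]

end WeakForm

section Hardy

variable {N : ℕ} {s p κ D : ℝ} {Ω : Set (E N)} {φ δ : E N → ℝ}

/-- The exterior ball condition, with `δ` playing the role of the distance to the boundary: the
complement of `Ω` contains a ball of radius `κ * δ x` within distance `D * δ x` of `x ∈ Ω`. -/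
def HasExteriorBalls (Ω : Set (E N)) (δ : E N → ℝ) (κ D : ℝ) : Prop :=
  ∀ x ∈ Ω, 0 < δ x ∧ ∃ c, ∀ y ∈ Metric.ball c (κ * δ x), y ∉ Ω ∧ ‖x - y‖ ≤ D * δ x

lemma mul_ofReal_le_lintegral_gagliardo (hps : 0 ≤ p * s) (hκ : 0 < κ) (hD : 0 < D) {d : ℝ}
    (hd : 0 < d) (hφ : ∀ᵐ y, y ∉ Ω → φ y = 0) {x c : E N} (hx : x ∈ Ω)
    (hball : ∀ y ∈ Metric.ball c (κ * d), y ∉ Ω ∧ ‖x - y‖ ≤ D * d) :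
    ENNReal.ofReal (D ^ (-((N : ℝ) + p * s)) * κ ^ N) * volume (Metric.ball (0 : E N) 1) *
        ENNReal.ofReal (|φ x| ^ p * d ^ (-(p * s))) ≤
      ∫⁻ y, ENNReal.ofReal (gagliardo s p φ (x, y)) := by
  have hlow : ∀ᵐ y, y ∈ Metric.ball c (κ * d) →
      ENNReal.ofReal (|φ x| ^ p * (D * d) ^ (-((N : ℝ) + p * s))) ≤
        ENNReal.ofReal (gagliardo s p φ (x, y)) := by
    filter_upwards [hφ] with y hy hyc
    obtain ⟨hyΩ, hxy⟩ := hball y hyc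
    have hpos : 0 < ‖x - y‖ := norm_sub_pos_iff.2 fun h => hyΩ (h ▸ hx)
    refine ENNReal.ofReal_le_ofReal ?_
    rw [gagliardo, hy hyΩ, sub_zero, div_eq_mul_inv, ← Real.rpow_neg (norm_nonneg _)]
    gcongr |φ x| ^ p * ?_
    exact Real.rpow_le_rpow_of_nonpos hpos hxy (by linarith [N.cast_nonneg (α := ℝ)])
  have hd' : d ^ (-(p * s)) = d ^ (-((N : ℝ) + p * s)) * d ^ N := by
    rw [← Real.rpow_natCast, ← Real.rpow_add hd]
    ring_nf
  calc _ = ENNReal.ofReal (|φ x| ^ p * (D * d) ^ (-((N : ℝ) + p * s))) *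
        volume (Metric.ball c (κ * d)) := by
        rw [Measure.addHaar_ball_of_pos _ c (by positivity), finrank_euclideanSpace_fin,
          mul_right_comm, ← mul_assoc, ← ENNReal.ofReal_mul (by positivity),
          ← ENNReal.ofReal_mul (by positivity), hd', Real.mul_rpow hD.le hd.le, mul_pow]
        ring_nf
    _ = ∫⁻ _ in Metric.ball c (κ * d),
          ENNReal.ofReal (|φ x| ^ p * (D * d) ^ (-((N : ℝ) + p * s))) := by
        rw [setLIntegral_const]
    _ ≤ ∫⁻ y in Metric.ball c (κ * d), ENNReal.ofReal (gagliardo s p φ (x, y)) :=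
        lintegral_mono_ae ((ae_restrict_iff' measurableSet_ball).2 hlow)
    _ ≤ _ := setLIntegral_le_lintegral _ _

lemma MemW0.integrable_rpow_mul_rpow_neg (hφ : MemW0 s p Ω φ) (hs : 0 ≤ s) (hp : 0 < p)
    (hκ : 0 < κ) (hD : 0 < D) (hδ : Measurable δ) (hΩ : HasExteriorBalls Ω δ κ D) :
    Integrable fun x => |φ x| ^ p * |δ x| ^ (-(p * s)) := by
  have hmeas : AEMeasurable fun x => |φ x| ^ p * |δ x| ^ (-(p * s)) :=
    (hφ.1.aemeasurable.abs.pow_const p).mul (hδ.abs.pow_const _).aemeasurable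
  refine ⟨hmeas.aestronglyMeasurable, ?_⟩
  rw [hasFiniteIntegral_iff_ofReal (Eventually.of_forall fun x => by positivity)]
  set c : ℝ≥0∞ := ENNReal.ofReal (D ^ (-((N : ℝ) + p * s)) * κ ^ N) *
    volume (Metric.ball (0 : E N) 1)
  have hc0 : c ≠ 0 := mul_ne_zero (ENNReal.ofReal_pos.2 (by positivity)).ne'
    (Metric.measure_ball_pos _ _ one_pos).ne'
  have hct : c ≠ ∞ := ENNReal.mul_ne_top ENNReal.ofReal_ne_top measure_ball_lt_top.ne
  have hgag := (hφ.integrable_gagliardo hp).lintegral_lt_top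
  have hgagm := (aestronglyMeasurable_gagliardo s p hφ.1).aemeasurable.ennreal_ofReal
  rw [Measure.volume_eq_prod] at hgag hgagm
  rw [lintegral_prod _ hgagm] at hgag
  have hslice : ∀ᵐ x, c * ENNReal.ofReal (|φ x| ^ p * |δ x| ^ (-(p * s))) ≤
      ∫⁻ y, ENNReal.ofReal (gagliardo s p φ (x, y)) := by
    filter_upwards [hφ.2.2] with x hx
    by_cases hxΩ : x ∈ Ω
    · obtain ⟨hδx, y, hy⟩ := hΩ x hxΩ
      rw [abs_of_pos hδx]
      exact mul_ofReal_le_lintegral_gagliardo (by positivity) hκ hD hδx hφ.2.2 hxΩ hy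
    · simp [hx hxΩ, Real.zero_rpow hp.ne']
  have hfin := (lintegral_mono_ae hslice).trans_lt hgag
  rw [lintegral_const_mul' _ _ hct] at hfin
  exact ENNReal.lt_top_of_mul_ne_top_right hfin.ne hc0

lemma MemW0.integrable_mul_rpow_neg (hφ : MemW0 s p Ω φ) (hs : 0 ≤ s) (hp : 1 ≤ p) (hκ : 0 < κ)
    (hD : 0 < D) (hΩ : Bornology.IsBounded Ω) (hδ : Measurable δ)
    (hball : HasExteriorBalls Ω δ κ D) : Integrable fun x => |φ x| * |δ x| ^ (-s) := by
  obtain ⟨R, hR⟩ := hΩ.subset_ball 0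
  have hHardy := hφ.integrable_rpow_mul_rpow_neg hs (one_pos.trans_le hp) hκ hD hδ hball
  have hone : Integrable ((Metric.ball (0 : E N) R).indicator fun _ => (1 : ℝ)) :=
    (integrable_indicator_iff measurableSet_ball).2 (integrableOn_const measure_ball_lt_top.ne)
  refine (hone.add hHardy).mono'
    (hφ.1.aemeasurable.abs.mul (hδ.abs.pow_const _).aemeasurable).aestronglyMeasurable ?_
  filter_upwards [hφ.2.2] with x hx
  by_cases hxΩ : x ∈ Ω
  · have hpow : (|φ x| * |δ x| ^ (-s)) ^ p = |φ x| ^ p * |δ x| ^ (-(p * s)) := by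
      rw [Real.mul_rpow (abs_nonneg _) (by positivity), ← Real.rpow_mul (abs_nonneg _)]
      ring_nf
    have hle := rpow_sub_one_mul_le_add hp zero_le_one
      (by positivity : 0 ≤ |φ x| * |δ x| ^ (-s))
    rw [Real.one_rpow, Real.one_rpow, one_mul, hpow] at hle
    rwa [Real.norm_of_nonneg (by positivity), Pi.add_apply, indicator_of_mem (hR hxΩ)]
  · simp only [hx hxΩ, abs_zero, zero_mul, norm_zero, Pi.add_apply]
    exact add_nonneg (indicator_apply_nonneg fun _ => zero_le_one) (by positivity)

end Hardy

section Truncated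

variable {N : ℕ} {s p l : ℝ} {Λ : ℝ≥0} {Ω : Set (E N)} {a φ : E N → ℝ}

/-- The kernel of the fractional `p`-Laplacian acting on `x ↦ (a x)_+ ^ s`, truncated in the
heights `a x` and `a y`. -/
noncomputable def truncKernel (s p l : ℝ) (a : E N → ℝ) (z : E N × E N) : ℝ :=
  truncInt s p l (a z.1) (a z.2) * ‖z.1 - z.2‖ ^ (-(N : ℝ) - p * s)

/-- The correspondingly truncated fractional `p`-Laplacian of `x ↦ (a x)_+ ^ s`, normalized without
the customary factor `2`. -/
noncomputable def truncOp (s p l : ℝ) (a : E N → ℝ) (x : E N) : ℝ :=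
  ∫ y, truncKernel s p l a (x, y)

lemma measurable_truncKernel (hs : 0 ≤ s) (p l : ℝ) (ha : Measurable a) :
    Measurable (truncKernel s p l a) :=
  ((measurable_truncInt hs p l).comp
    ((ha.comp measurable_fst).prodMk (ha.comp measurable_snd))).mul (by fun_prop)

lemma truncKernel_swap (z : E N × E N) : truncKernel s p l a z.swap = -truncKernel s p l a z := by
  rw [truncKernel, truncKernel, Prod.fst_swap, Prod.snd_swap, truncInt_symm, norm_sub_rev, neg_mul]

lemma abs_truncKernel_le_indicator (hs0 : 0 ≤ s) (hs1 : s ≤ 1) (hp : 1 < p) (hl0 : 0 ≤ l)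
    (hl1 : l < 1) (ha : LipschitzWith Λ a) (hΛ : 0 < Λ) {z : E N × E N} (hz : 0 < a z.1) :
    |truncKernel s p l a z| ≤ Λ ^ (s * (p - 1)) *
      (Ici ((1 - l) * a z.1 / Λ)).indicator (fun d => d ^ (-(N : ℝ) - s)) ‖z.1 - z.2‖ := by
  have hΛ' : (0 : ℝ) < Λ := hΛ
  by_cases h : OffDiag l (a z.1) (a z.2)
  · have hlip : |a z.1 - a z.2| ≤ Λ * ‖z.1 - z.2‖ := ha.norm_sub_le z.1 z.2
    have hle : (1 - l) * a z.1 / Λ ≤ ‖z.1 - z.2‖ :=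
      (div_le_iff₀' hΛ').2 ((h.le_abs_sub hl0 hl1.le hz).trans hlip)
    have hpos : 0 < ‖z.1 - z.2‖ :=
      (div_pos (mul_pos (sub_pos.2 hl1) hz) hΛ').trans_le hle
    rw [indicator_of_mem (by exact hle), truncKernel, abs_mul,
      abs_of_nonneg (Real.rpow_nonneg hpos.le _), ← rpow_mul_rpow_neg_sub N s p hpos, ← mul_assoc,
      ← Real.mul_rpow hΛ'.le hpos.le]
    gcongr
    exact (abs_truncInt_le hs0 hs1 hp l _ _).trans
      (Real.rpow_le_rpow (abs_nonneg _) hlip (mul_nonneg hs0 (sub_pos.2 hp).le))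
  · rw [truncKernel, truncInt_of_not_offDiag h, zero_mul, abs_zero]
    exact mul_nonneg (by positivity) (indicator_apply_nonneg fun _ => by positivity)

lemma integrable_truncKernel_right [Nontrivial (E N)] (hs0 : 0 < s) (hs1 : s ≤ 1) (hp : 1 < p)
    (hl0 : 0 ≤ l) (hl1 : l < 1) (ha : LipschitzWith Λ a) (hΛ : 0 < Λ) {x : E N} (hx : 0 < a x) :
    Integrable fun y => truncKernel s p l a (x, y) := by
  have hR : 0 < (1 - l) * a x / Λ := div_pos (mul_pos (sub_pos.2 hl1) hx) hΛ
  have hk := integrable_indicator_Ici_norm_rpow (F := E N) volume hs0 hR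
  rw [finrank_euclideanSpace_fin] at hk
  exact ((hk.comp_sub_left x).const_mul (Λ ^ (s * (p - 1)) : ℝ)).mono'
    ((measurable_truncKernel hs0.le p l ha.continuous.measurable).comp
      measurable_prodMk_left).aestronglyMeasurable
    (Eventually.of_forall fun y =>
      abs_truncKernel_le_indicator hs0.le hs1 hp hl0 hl1 ha hΛ (z := (x, y)) hx)

lemma integral_abs_truncKernel_le [Nontrivial (E N)] (hs0 : 0 < s) (hs1 : s ≤ 1) (hp : 1 < p)
    (hl0 : 0 ≤ l) (hl1 : l < 1) (ha : LipschitzWith Λ a) (hΛ : 0 < Λ) {x : E N} (hx : 0 < a x) :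
    ∫ y, |truncKernel s p l a (x, y)| ≤ Λ ^ (s * (p - 1)) * ((1 - l) / Λ) ^ (-s) *
      (∫ h : E N, (Ici 1).indicator (fun d => d ^ (-(N : ℝ) - s)) ‖h‖) * a x ^ (-s) := by
  have hR : 0 < (1 - l) * a x / Λ := div_pos (mul_pos (sub_pos.2 hl1) hx) hΛ
  have hk := integrable_indicator_Ici_norm_rpow (F := E N) volume hs0 hR
  have hscale := integral_indicator_Ici_norm_rpow (F := E N) (s := s) volume hR
  rw [finrank_euclideanSpace_fin] at hk hscale
  calc ∫ y, |truncKernel s p l a (x, y)|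
      ≤ ∫ y, Λ ^ (s * (p - 1)) * (Ici ((1 - l) * a x / Λ)).indicator
          (fun d => d ^ (-(N : ℝ) - s)) ‖x - y‖ :=
        integral_mono_of_nonneg (Eventually.of_forall fun y => abs_nonneg _)
          ((hk.comp_sub_left x).const_mul _) (Eventually.of_forall fun y =>
            abs_truncKernel_le_indicator hs0.le hs1 hp hl0 hl1 ha hΛ (z := (x, y)) hx)
    _ = Λ ^ (s * (p - 1)) * (((1 - l) * a x / Λ) ^ (-s) *
          ∫ h : E N, (Ici 1).indicator (fun d => d ^ (-(N : ℝ) - s)) ‖h‖) := by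
        rw [integral_const_mul, integral_sub_left_eq_self (fun h : E N =>
          (Ici ((1 - l) * a x / Λ)).indicator (fun d => d ^ (-(N : ℝ) - s)) ‖h‖), hscale]
    _ = _ := by
        rw [mul_div_right_comm, Real.mul_rpow (div_nonneg (sub_pos.2 hl1).le Λ.coe_nonneg) hx.le]
        ring

lemma MemW0.ae_pos_of_ne_zero (hφ : MemW0 s p Ω φ) (hΩ : ∀ x ∈ Ω, 0 < a x) :
    ∀ᵐ x, φ x ≠ 0 → 0 < a x := by
  filter_upwards [hφ.2.2] with x hx hne using hΩ x (not_imp_comm.1 hx hne)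

lemma MemW0.integrable_mul_truncKernel [Nontrivial (E N)] (hφ : MemW0 s p Ω φ) (hs0 : 0 < s)
    (hs1 : s ≤ 1) (hp : 1 < p) (hl0 : 0 ≤ l) (hl1 : l < 1) (ha : LipschitzWith Λ a) (hΛ : 0 < Λ)
    (hΩ : ∀ x ∈ Ω, 0 < a x) (hHardy : Integrable fun x => |φ x| * |a x| ^ (-s)) :
    Integrable (fun z : E N × E N => φ z.1 * truncKernel s p l a z)
      ((volume : Measure (E N)).prod volume) := by
  have hmeas : AEStronglyMeasurable (fun z : E N × E N => φ z.1 * truncKernel s p l a z)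
      ((volume : Measure (E N)).prod volume) :=
    hφ.1.comp_fst.mul
      (measurable_truncKernel hs0.le p l ha.continuous.measurable).aestronglyMeasurable
  refine (integrable_prod_iff hmeas).2 ⟨?_, ?_⟩
  · filter_upwards [hφ.ae_pos_of_ne_zero hΩ] with x hx
    rcases eq_or_ne (φ x) 0 with h0 | h0
    · simp [h0]
    · exact (integrable_truncKernel_right hs0 hs1 hp hl0 hl1 ha hΛ (hx h0)).const_mul _
  · refine (hHardy.const_mul (Λ ^ (s * (p - 1)) * ((1 - l) / Λ) ^ (-s) *
      ∫ h : E N, (Ici 1).indicator (fun d => d ^ (-(N : ℝ) - s)) ‖h‖)).mono'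
      hmeas.norm.integral_prod_right' ?_
    filter_upwards [hφ.ae_pos_of_ne_zero hΩ] with x hx
    rw [Real.norm_of_nonneg (integral_nonneg fun y => norm_nonneg _)]
    rcases eq_or_ne (φ x) 0 with h0 | h0
    · simp [h0]
    · simp only [norm_mul (φ x), Real.norm_eq_abs]
      rw [integral_const_mul, abs_of_pos (hx h0)]
      calc _ ≤ |φ x| * _ := mul_le_mul_of_nonneg_left
            (integral_abs_truncKernel_le hs0 hs1 hp hl0 hl1 ha hΛ (hx h0)) (abs_nonneg _)
        _ = _ := by ring

lemma integral_truncKernel_mul_sub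
    (hint : Integrable (fun z : E N × E N => φ z.1 * truncKernel s p l a z)
      ((volume : Measure (E N)).prod volume)) :
    ∫ z, truncKernel s p l a z * (φ z.1 - φ z.2) = ∫ x, φ x * (2 * truncOp s p l a x) := by
  set g : E N × E N → ℝ := fun z => φ z.1 * truncKernel s p l a z
  have hsplit : ∀ z, truncKernel s p l a z * (φ z.1 - φ z.2) = g z + g z.swap := fun z => by
    simp only [g, truncKernel_swap, Prod.fst_swap]
    ring
  have hadd := integral_add hint hint.swap
  simp only [Function.comp_apply] at hadd
  simp_rw [hsplit]
  rw [Measure.volume_eq_prod, hadd, integral_prod_swap g, integral_prod g hint, ← two_mul,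
    ← integral_const_mul]
  refine integral_congr_ae (Eventually.of_forall fun x => ?_)
  simp only [g, integral_const_mul, truncOp]
  ring

lemma weakForm_posPow_comp_eq (z : E N × E N) :
    weakForm s p (fun x => posPow s (a x)) φ z =
      spow (posPow s (a z.1) - posPow s (a z.2)) (p - 1) * ‖z.1 - z.2‖ ^ (-(N : ℝ) - p * s) *
        (φ z.1 - φ z.2) := by
  rw [weakForm, div_eq_mul_inv, ← Real.rpow_neg (norm_nonneg _), neg_add', mul_right_comm]

lemma tendsto_integral_truncKernel_mul_sub (hs : 0 ≤ s) (ha : Measurable a)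
    (hφ : AEStronglyMeasurable φ volume)
    (hweak : Integrable (weakForm s p (fun x => posPow s (a x)) φ)) :
    Tendsto (fun l => ∫ z, truncKernel s p l a z * (φ z.1 - φ z.2)) (𝓝[<] 1)
      (𝓝 (∫ z, weakForm s p (fun x => posPow s (a x)) φ z)) := by
  refine tendsto_integral_filter_of_dominated_convergence _ (Eventually.of_forall fun l => ?_)
    (Eventually.of_forall fun l => Eventually.of_forall fun z => ?_) hweak.norm
    (Eventually.of_forall fun z => tendsto_const_nhds.congr' ?_)
  · exact (measurable_truncKernel hs p l ha).aestronglyMeasurable.mul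
      (hφ.comp_fst.sub hφ.comp_snd)
  · rw [weakForm_posPow_comp_eq, truncKernel, norm_mul, norm_mul, norm_mul, norm_mul]
    gcongr
    unfold truncInt
    split_ifs
    · exact le_rfl
    · rw [norm_zero]
      exact norm_nonneg _
  · filter_upwards [eventually_truncInt_eq s p (a z.1) (a z.2)] with l hl
    rw [weakForm_posPow_comp_eq, truncKernel, hl]

lemma MemW0.tendsto_integral_mul_truncOp [Nontrivial (E N)] (hφ : MemW0 s p Ω φ) (hs0 : 0 < s)
    (hs1 : s ≤ 1) (hp : 1 < p) (ha : LipschitzWith Λ a) (hΛ : 0 < Λ)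
    (hbdd : Bornology.IsBounded Ω) (hΩ : ∀ x ∈ Ω, 0 < a x)
    (hHardy : Integrable fun x => |φ x| * |a x| ^ (-s)) {F : E N → ℝ} {C₁ C₂ : ℝ}
    (hbound : ∀ x ∈ Ω, ∀ l ∈ Ioo (0 : ℝ) 1, |truncOp s p l a x| ≤ C₁ + C₂ * a x ^ (-s))
    (hlim : ∀ x ∈ Ω, Tendsto (fun l => truncOp s p l a x) (𝓝[<] 1) (𝓝 (F x))) :
    Tendsto (fun l => ∫ x, φ x * (2 * truncOp s p l a x)) (𝓝[<] 1)
      (𝓝 (∫ x, φ x * (2 * F x))) := by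
  have hIoo : ∀ᶠ l : ℝ in 𝓝[<] 1, l ∈ Ioo (0 : ℝ) 1 := Ioo_mem_nhdsLT one_pos
  have hdom := ((hφ.integrable hp.le hbdd).abs.const_mul (2 * C₁)).add (hHardy.const_mul (2 * C₂))
  refine tendsto_integral_filter_of_dominated_convergence _ ?_ ?_ hdom ?_
  · filter_upwards [hIoo] with l hl
    have hint := (hφ.integrable_mul_truncKernel hs0 hs1 hp hl.1.le hl.2 ha hΛ hΩ
      hHardy).integral_prod_left
    refine (hint.const_mul 2).aestronglyMeasurable.congr (Eventually.of_forall fun x => ?_)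
    simp only [integral_const_mul, truncOp]
    ring
  · filter_upwards [hIoo] with l hl
    filter_upwards [hφ.2.2] with x hx
    by_cases hxΩ : x ∈ Ω
    · rw [norm_mul, norm_mul, Real.norm_two, Real.norm_eq_abs, Real.norm_eq_abs, Pi.add_apply,
        abs_of_pos (hΩ x hxΩ)]
      calc _ ≤ |φ x| * (2 * (C₁ + C₂ * a x ^ (-s))) := by
            gcongr
            exact hbound x hxΩ l hl
        _ = _ := by ring
    · simp [hx hxΩ]
  · filter_upwards [hφ.2.2] with x hx
    by_cases hxΩ : x ∈ Ω
    · exact ((hlim x hxΩ).const_mul 2).const_mul _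
    · simp [hx hxΩ]

/-- Antisymmetry of the truncated kernel moves the difference of test functions onto a factor `2`;
Hardy's inequality, through `hHardy`, dominates the passage to the limit `l → 1`. -/
lemma MemW0.integral_weakForm_eq [Nontrivial (E N)] (hφ : MemW0 s p Ω φ) (hs0 : 0 < s)
    (hs1 : s ≤ 1) (hp : 1 < p) (ha : LipschitzWith Λ a) (hΛ : 0 < Λ)
    (hbdd : Bornology.IsBounded Ω) (hΩ : ∀ x ∈ Ω, 0 < a x)
    (hHardy : Integrable fun x => |φ x| * |a x| ^ (-s))
    (hweak : Integrable (weakForm s p (fun x => posPow s (a x)) φ)) {F : E N → ℝ} {C₁ C₂ : ℝ}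
    (hbound : ∀ x ∈ Ω, ∀ l ∈ Ioo (0 : ℝ) 1, |truncOp s p l a x| ≤ C₁ + C₂ * a x ^ (-s))
    (hlim : ∀ x ∈ Ω, Tendsto (fun l => truncOp s p l a x) (𝓝[<] 1) (𝓝 (F x))) :
    ∫ z, weakForm s p (fun x => posPow s (a x)) φ z = ∫ x in Ω, (2 * F x) * φ x := by
  have hIoo : ∀ᶠ l : ℝ in 𝓝[<] 1, l ∈ Ioo (0 : ℝ) 1 := Ioo_mem_nhdsLT one_pos
  have hleft := tendsto_integral_truncKernel_mul_sub hs0.le ha.continuous.measurable hφ.1 hweak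
  have hright := hφ.tendsto_integral_mul_truncOp hs0 hs1 hp ha hΛ hbdd hΩ hHardy hbound hlim
  have heq : ∀ᶠ l : ℝ in 𝓝[<] 1, ∫ x, φ x * (2 * truncOp s p l a x) =
      ∫ z, truncKernel s p l a z * (φ z.1 - φ z.2) := by
    filter_upwards [hIoo] with l hl
    exact (integral_truncKernel_mul_sub
      (hφ.integrable_mul_truncKernel hs0 hs1 hp hl.1.le hl.2 ha hΛ hΩ hHardy)).symm
  rw [tendsto_nhds_unique hleft (hright.congr' heq),
    setIntegral_eq_integral_of_ae_compl_eq_zero]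
  · simp only [mul_comm]
  · filter_upwards [hφ.2.2] with x hx hxΩ
    rw [hx hxΩ, mul_zero]

end Truncated

section Diffeomorphism

lemma nnnorm_le_of_eLpNorm_top_le {X G : Type*} [TopologicalSpace X] [MeasurableSpace X]
    [NormedAddCommGroup G] {μ : Measure X} [μ.IsOpenPosMeasure] {g : X → G} (hg : Continuous g)
    {M : ℝ≥0} (h : eLpNorm g ∞ μ ≤ M) (x : X) : ‖g x‖₊ ≤ M := by
  rw [eLpNorm_exponent_top] at h
  have hae : ∀ᵐ x ∂μ, ‖g x‖₊ ≤ M := by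
    filter_upwards [ae_le_eLpNormEssSup (f := g) (μ := μ)] with x hx
    exact ENNReal.coe_le_coe.1 (hx.trans h)
  have hclosed : IsClosed {x | ‖g x‖₊ ≤ M} := isClosed_le hg.nnnorm continuous_const
  exact (hclosed.closure_eq.symm.trans (Measure.dense_of_ae hae).closure_eq).ge (mem_univ x)

lemma ae_norm_le_toNNReal_eLpNorm_top {X G : Type*} [MeasurableSpace X] [NormedAddCommGroup G]
    {μ : Measure X} {g : X → G} (h : eLpNorm g ∞ μ ≠ ∞) :
    ∀ᵐ x ∂μ, ‖g x‖ ≤ (eLpNorm g ∞ μ).toNNReal := by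
  rw [eLpNorm_exponent_top] at h ⊢
  filter_upwards [ae_le_eLpNormEssSup (f := g) (μ := μ)] with x hx
  exact ENNReal.toNNReal_mono h hx

variable {F : Type*} [NormedAddCommGroup F] [NormedSpace ℝ F]

lemma eLpNorm_fderiv_top_le {G : Type*} [NormedAddCommGroup G] [NormedSpace ℝ G]
    [MeasurableSpace F] {g : F → G} {L : ℝ≥0} (hg : LipschitzWith L g) (μ : Measure F) :
    eLpNorm (fderiv ℝ g) ∞ μ ≤ L := by
  rw [eLpNorm_exponent_top]
  exact eLpNormEssSup_le_of_ae_nnnorm_bound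
    (Eventually.of_forall fun x => norm_fderiv_le_of_lipschitz ℝ hg)

lemma norm_sub_le_mul_min_of_eq_of_lt_norm [Nontrivial F] {G : Type*} [NormedAddCommGroup G]
    {g : F → G} {K : ℝ≥0} (hg : LipschitzWith K g) {r : ℝ} (hr : 0 < r) {c : G}
    (hc : ∀ x, r < ‖x‖ → g x = c) (x y : F) : ‖g x - g y‖ ≤ K * min ‖x - y‖ (6 * r) := by
  have hdist : ∀ x, ‖g x - c‖ ≤ K * (3 * r) := fun x => by
    rcases lt_or_ge r ‖x‖ with hx | hx
    · rw [hc x hx, sub_self, norm_zero]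
      positivity
    · obtain ⟨z, hz⟩ := exists_norm_eq F (show 0 ≤ 3 * r by positivity)
      have hxz : r < ‖x + z‖ := by
        have := norm_sub_le (x + z) x
        rw [add_sub_cancel_left, hz] at this
        linarith
      have := hg.norm_sub_le x (x + z)
      rwa [hc _ hxz, sub_add_cancel_left, norm_neg, hz] at this
  rw [mul_min_of_nonneg _ _ K.coe_nonneg]
  refine le_min (hg.norm_sub_le x y) ?_
  calc ‖g x - g y‖ = ‖(g x - c) - (g y - c)‖ := by rw [sub_sub_sub_cancel_right]
    _ ≤ ‖g x - c‖ + ‖g y - c‖ := norm_sub_le _ _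
    _ ≤ K * (6 * r) := by linarith [hdist x, hdist y]

/-- Quantitative `C^{1,1}` bounds for a diffeomorphism: `M` and `M'` bound the first derivatives of
`Φ` and `Φ⁻¹`, and `DΦ` is `K`-Lipschitz with total oscillation at most `K R`. -/
structure HasC11Bounds (Φ : F ≃ F) (R : ℝ) (M M' K : ℝ≥0) : Prop where
  contDiff : ContDiff ℝ 1 Φ
  contDiff_symm : ContDiff ℝ 1 Φ.symm
  nnnorm_fderiv_le : ∀ x, ‖fderiv ℝ Φ x‖₊ ≤ M
  nnnorm_fderiv_symm_le : ∀ x, ‖fderiv ℝ Φ.symm x‖₊ ≤ M'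
  norm_fderiv_sub_le : ∀ x y, ‖fderiv ℝ Φ x - fderiv ℝ Φ y‖ ≤ K * min ‖x - y‖ R

lemma IsC11.supD2_ne_top {N : ℕ} {g : E N → E N} (hg : IsC11 g) : supD2 g ≠ ∞ :=
  let ⟨_, hL⟩ := hg.2
  ne_top_of_le_ne_top ENNReal.coe_ne_top (eLpNorm_fderiv_top_le hL volume)

lemma IsC11Diffeo.hasC11Bounds {N : ℕ} [Nontrivial (E N)] {Φ : E N ≃ E N} {M M' : ℝ≥0} {r : ℝ}
    (hΦ : IsC11Diffeo Φ) (hr : 0 < r) (hfix : ∀ x, x ∉ Metric.ball 0 r → Φ x = x)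
    (hM : supD Φ ≤ M) (hM' : supD Φ.symm ≤ M') :
    HasC11Bounds Φ (6 * r) M M' (supD2 Φ).toNNReal where
  contDiff := hΦ.1.1
  contDiff_symm := hΦ.2.1
  nnnorm_fderiv_le :=
    nnnorm_le_of_eLpNorm_top_le (hΦ.1.1.continuous_fderiv one_ne_zero) hM
  nnnorm_fderiv_symm_le :=
    nnnorm_le_of_eLpNorm_top_le (hΦ.2.1.continuous_fderiv one_ne_zero) hM'
  norm_fderiv_sub_le := by
    obtain ⟨L, hL⟩ := hΦ.1.2
    have hlip : LipschitzWith (supD2 Φ).toNNReal (fderiv ℝ Φ) := LipschitzWith.of_dist_le_mul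
      fun x y => by
        rw [dist_eq_norm, dist_eq_norm]
        exact norm_sub_le_of_ae_norm_fderiv_le hL
          (ae_norm_le_toNNReal_eLpNorm_top hΦ.1.supD2_ne_top) x y
    refine norm_sub_le_mul_min_of_eq_of_lt_norm hlip hr (c := .id ℝ (E N)) fun x hx => ?_
    have hid : (Φ : E N → E N) =ᶠ[𝓝 x] id := by
      filter_upwards [(isOpen_lt continuous_const continuous_norm).mem_nhds hx] with z hz
      exact hfix z (by simpa using le_of_lt hz)
    rw [hid.fderiv_eq, fderiv_id]

namespace HasC11Bounds

variable {Φ : F ≃ F} {R : ℝ} {M M' K : ℝ≥0}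

lemma differentiable (h : HasC11Bounds Φ R M M' K) : Differentiable ℝ Φ :=
  h.contDiff.differentiable one_ne_zero

lemma continuous_fderiv (h : HasC11Bounds Φ R M M' K) : Continuous (fderiv ℝ Φ) :=
  h.contDiff.continuous_fderiv one_ne_zero

lemma lipschitzWith (h : HasC11Bounds Φ R M M' K) : LipschitzWith M Φ :=
  lipschitzWith_of_nnnorm_fderiv_le h.differentiable h.nnnorm_fderiv_le

lemma lipschitzWith_symm (h : HasC11Bounds Φ R M M' K) : LipschitzWith M' Φ.symm :=
  lipschitzWith_of_nnnorm_fderiv_le (h.contDiff_symm.differentiable one_ne_zero)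
    h.nnnorm_fderiv_symm_le

lemma norm_sub_le (h : HasC11Bounds Φ R M M' K) (w z : F) : ‖w - z‖ ≤ M' * ‖Φ w - Φ z‖ := by
  simpa using h.lipschitzWith_symm.norm_sub_le (Φ w) (Φ z)

lemma norm_le_mul_norm_fderiv (h : HasC11Bounds Φ R M M' K) (x v : F) :
    ‖v‖ ≤ M' * ‖fderiv ℝ Φ x v‖ := by
  have hcomp : fderiv ℝ (Φ.symm ∘ Φ) x = (fderiv ℝ Φ.symm (Φ x)).comp (fderiv ℝ Φ x) :=
    fderiv_comp x (h.contDiff_symm.differentiable one_ne_zero _) (h.differentiable x)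
  rw [Φ.symm_comp_self, fderiv_id] at hcomp
  calc ‖v‖ = ‖fderiv ℝ Φ.symm (Φ x) (fderiv ℝ Φ x v)‖ := congrArg (fun A => ‖A v‖) hcomp
    _ ≤ M' * ‖fderiv ℝ Φ x v‖ :=
      ContinuousLinearMap.le_of_opNorm_le _ (h.nnnorm_fderiv_symm_le _) _

lemma norm_sub_sub_fderiv_le (h : HasC11Bounds Φ R M M' K) (w z : F) :
    ‖Φ w - Φ z - fderiv ℝ Φ w (w - z)‖ ≤ K * min ‖w - z‖ R * ‖w - z‖ := by
  refine (convex_closedBall w ‖w - z‖).norm_image_sub_le_of_norm_fderiv_le' (𝕜 := ℝ)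
    (fun x _ => h.differentiable x) (fun x hx => (h.norm_fderiv_sub_le x w).trans ?_)
    (by simp [dist_eq_norm, norm_sub_rev]) (by simp)
  gcongr
  simpa [dist_eq_norm] using hx

end HasC11Bounds

variable [FiniteDimensional ℝ F]

lemma contDiff_det {k : WithTop ℕ∞} : ContDiff ℝ k fun A : F →L[ℝ] F => A.det := by
  let b := finBasis ℝ F
  have hdet : (fun A : F →L[ℝ] F => A.det) = fun A =>
      (Matrix.of fun i j => LinearMap.toContinuousLinearMap (b.coord i) (A (b j))).det := by
    ext A
    exact (LinearMap.det_toMatrix b (A : F →ₗ[ℝ] F)).symm.trans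
      (congrArg Matrix.det (by ext; simp [LinearMap.toMatrix_apply]))
  simp only [hdet, Matrix.det_apply, Matrix.of_apply]
  exact ContDiff.sum fun σ _ => (contDiff_prod fun i _ =>
    (ContinuousLinearMap.contDiff _).comp (contDiff_id.clm_apply contDiff_const)).const_smul _

lemma exists_abs_det_bounds (M : ℝ) :
    ∃ L : ℝ, 0 ≤ L ∧ (∀ A : F →L[ℝ] F, ‖A‖ ≤ M → |A.det| ≤ L) ∧
      ∀ A B : F →L[ℝ] F, ‖A‖ ≤ M → ‖B‖ ≤ M → |(|A.det| - |B.det|)| ≤ L * ‖A - B‖ := by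
  have hcompact : IsCompact (Metric.closedBall (0 : F →L[ℝ] F) M) := isCompact_closedBall _ _
  obtain ⟨L₁, hL₁⟩ := (contDiff_det (F := F) (k := 1)).contDiffOn.exists_lipschitzOnWith
    one_ne_zero (convex_closedBall 0 M) hcompact
  obtain ⟨L₂, hL₂⟩ := hcompact.exists_bound_of_continuousOn
    (ContinuousLinearMap.continuous_det (𝕜 := ℝ) (E := F)).continuousOn
  refine ⟨max L₁ L₂, le_max_of_le_left L₁.2, fun A hA => ?_, fun A B hA hB => ?_⟩
  · exact (hL₂ A (by simpa using hA)).trans (le_max_right _ _)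
  · calc |(|A.det| - |B.det|)| ≤ |A.det - B.det| := abs_abs_sub_abs_le_abs_sub _ _
      _ ≤ L₁ * ‖A - B‖ := hL₁.norm_sub_le (by simpa using hA) (by simpa using hB)
      _ ≤ _ := by
        gcongr
        exact le_max_left _ _

lemma rpow_le_mul_rpow_of_le_mul {β c x y : ℝ} (hβ : β ≤ 0) (hc : 0 < c) (hx : 0 < x)
    (hxy : x ≤ c * y) : y ^ β ≤ c ^ (-β) * x ^ β := by
  refine (Real.rpow_le_rpow_of_nonpos (div_pos hx hc) ((div_le_iff₀' hc).2 hxy) hβ).trans_eq ?_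
  rw [Real.div_rpow hx.le hc.le, Real.rpow_neg hc.le, div_eq_inv_mul]

lemma abs_rpow_sub_rpow_le {β l x y : ℝ} (hβ : β ≤ 1) (hl : 0 < l) (hx : l ≤ x) (hy : l ≤ y) :
    |x ^ β - y ^ β| ≤ |β| * l ^ (β - 1) * |x - y| := by
  refine (convex_Ici l).norm_image_sub_le_of_norm_hasDerivWithin_le (𝕜 := ℝ)
    (f := fun x : ℝ => x ^ β) (f' := fun x => β * x ^ (β - 1)) (fun z (hz : l ≤ z) => ?_)
    (fun z (hz : l ≤ z) => ?_) hy hx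
  · exact (Real.hasDerivAt_rpow_const (Or.inl (hl.trans_le hz).ne')).hasDerivWithinAt
  · rw [norm_mul, Real.norm_eq_abs, Real.norm_of_nonneg (Real.rpow_nonneg (hl.le.trans hz) _)]
    exact mul_le_mul_of_nonneg_left
      (Real.rpow_le_rpow_of_nonpos hl hz (sub_nonpos.2 hβ)) (abs_nonneg β)

lemma abs_mul_rpow_sub_mul_rpow_le {β l x y : ℝ} (hβ : β ≤ 0) (hl : 0 < l) (hx : l ≤ x)
    (hy : l ≤ y) (c d : ℝ) :
    |c * x ^ β - d * y ^ β| ≤ |c| * (|β| * l ^ (β - 1) * |x - y|) + |c - d| * l ^ β := by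
  have hy0 : 0 ≤ y ^ β := Real.rpow_nonneg (hl.le.trans hy) β
  calc |c * x ^ β - d * y ^ β| = |c * (x ^ β - y ^ β) + (c - d) * y ^ β| := by ring_nf
    _ ≤ |c| * |x ^ β - y ^ β| + |c - d| * y ^ β := by
      refine (abs_add_le _ _).trans_eq ?_
      rw [abs_mul, abs_mul, abs_of_nonneg hy0]
    _ ≤ _ := by
      gcongr ?_ * ?_ + ?_ * ?_
      · exact abs_rpow_sub_rpow_le (hβ.trans zero_le_one) hl hx hy
      · exact Real.rpow_le_rpow_of_nonpos hl hy hβ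

/-- The kernel `‖x - y‖ ^ β` transported by `Φ`, with the Jacobian of the second variable, minus
its version with coefficients frozen at the first variable. -/
noncomputable def kernelDiff (β : ℝ) (Φ : F → F) (w z : F) : ℝ :=
  |(fderiv ℝ Φ z).det| * ‖Φ w - Φ z‖ ^ β -
    |(fderiv ℝ Φ w).det| * ‖fderiv ℝ Φ w (w - z)‖ ^ β

lemma exists_abs_kernelDiff_le {β R : ℝ} {M M' : ℝ≥0} (hβ : β < 0) (hM' : 0 < M') (hR : 0 ≤ R) :
    ∃ C : ℝ, 0 ≤ C ∧ ∀ (Φ : F ≃ F) (K : ℝ≥0), HasC11Bounds Φ R M M' K →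
      ∀ w z, |kernelDiff β Φ w z| ≤ C * K * (min ‖w - z‖ R * ‖w - z‖ ^ β) := by
  obtain ⟨L, hL0, hdet, hdet_sub⟩ := exists_abs_det_bounds (F := F) M
  refine ⟨L * (|β| * M' + 1) * M' ^ (-β), by positivity, fun Φ K h w z => ?_⟩
  rcases eq_or_ne w z with rfl | hwz
  · simp [kernelDiff, Real.zero_rpow hβ.ne]
  have hpos : 0 < ‖w - z‖ := norm_pos_iff.2 (sub_ne_zero.2 hwz)
  have hM'0 : (0 : ℝ) < M' := hM'
  set d := ‖w - z‖
  set m := min d R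
  have : 0 ≤ m := le_min hpos.le hR
  have hl : 0 < d / M' := div_pos hpos hM'0
  have hdist : |‖Φ w - Φ z‖ - ‖fderiv ℝ Φ w (w - z)‖| ≤ K * m * d :=
    (abs_norm_sub_norm_le _ _).trans (h.norm_sub_sub_fderiv_le w z)
  have hjac : |(|(fderiv ℝ Φ z).det| - |(fderiv ℝ Φ w).det|)| ≤ L * (K * m) := by
    refine (hdet_sub _ _ (h.nnnorm_fderiv_le z) (h.nnnorm_fderiv_le w)).trans ?_
    gcongr
    rw [norm_sub_rev]
    exact h.norm_fderiv_sub_le w z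
  have hexp : (d / M') ^ (β - 1) * d = M' * (d / M') ^ β := by
    rw [Real.rpow_sub_one hl.ne']
    field_simp
  calc |kernelDiff β Φ w z|
      ≤ |(|(fderiv ℝ Φ z).det|)| * (|β| * (d / M') ^ (β - 1) *
          |‖Φ w - Φ z‖ - ‖fderiv ℝ Φ w (w - z)‖|) +
          |(|(fderiv ℝ Φ z).det| - |(fderiv ℝ Φ w).det|)| * (d / M') ^ β :=
        abs_mul_rpow_sub_mul_rpow_le hβ.le hl ((div_le_iff₀' hM'0).2 (h.norm_sub_le w z))
          ((div_le_iff₀' hM'0).2 (h.norm_le_mul_norm_fderiv w _)) _ _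
    _ ≤ L * (|β| * (d / M') ^ (β - 1) * (K * m * d)) + L * (K * m) * (d / M') ^ β := by
        rw [abs_abs]
        gcongr
        exact hdet _ (h.nnnorm_fderiv_le z)
    _ = L * (|β| * M' + 1) * (K * m) * (d / M') ^ β := by
        linear_combination L * |β| * K * m * hexp
    _ = L * (|β| * M' + 1) * M' ^ (-β) * K * (m * d ^ β) := by
        rw [Real.div_rpow hpos.le hM'0.le, Real.rpow_neg hM'0.le, div_eq_inv_mul]
        ring

variable [MeasurableSpace F] [BorelSpace F]

lemma integral_eq_integral_abs_det_fderiv_mul (μ : Measure F) [μ.IsAddHaarMeasure] {Φ : F ≃ F}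
    (hΦ : Differentiable ℝ Φ) (g : F → ℝ) :
    ∫ y, g y ∂μ = ∫ z, |(fderiv ℝ Φ z).det| * g (Φ z) ∂μ := by
  have := integral_image_eq_integral_abs_det_fderiv_smul μ MeasurableSet.univ
    (fun x _ => (hΦ x).hasFDerivAt.hasFDerivWithinAt) Φ.injective.injOn g
  rwa [image_univ, Φ.surjective.range_eq, setIntegral_univ, setIntegral_univ] at this

lemma HasC11Bounds.measurable_kernelDiff {Φ : F ≃ F} {R : ℝ} {M M' K : ℝ≥0}
    (h : HasC11Bounds Φ R M M' K) (β : ℝ) :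
    Measurable fun q : F × F => kernelDiff β Φ q.1 q.2 := by
  have hΦ : Measurable Φ := h.contDiff.continuous.measurable
  have hdet : Measurable fun x => |(fderiv ℝ Φ x).det| :=
    (ContinuousLinearMap.continuous_det.comp h.continuous_fderiv).abs.measurable
  have hfderiv : Measurable fun q : F × F => fderiv ℝ Φ q.1 (q.1 - q.2) :=
    ((h.continuous_fderiv.comp continuous_fst).clm_apply
      (continuous_fst.sub continuous_snd)).measurable
  exact ((hdet.comp measurable_snd).mul (((hΦ.comp measurable_fst).sub
    (hΦ.comp measurable_snd)).norm.pow_const _)).sub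
    ((hdet.comp measurable_fst).mul (hfderiv.norm.pow_const _))

end Diffeomorphism

section Transported

variable {N : ℕ} {s p R l : ℝ} {M M' K : ℝ≥0} {Φ : E N ≃ E N} {w : E N}

/-- The height `Φ⁻¹(x) · e_N` of `x` above the boundary of `Φ(ℝ^N_+)`. -/
def height (hN : 1 ≤ N) (Φ : E N ≃ E N) (x : E N) : ℝ :=
  lastCoord hN (Φ.symm x)

/-- Half of `(-Δ)_p^s` of `x ↦ (Φ⁻¹(x) · e_N)_+ ^ s` at `Φ w`: the operator of `x ↦ (x · e_N)_+ ^ s`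
with kernel `kernelDiff`. -/
noncomputable def residual (hN : 1 ≤ N) (s p : ℝ) (Φ : E N → E N) (w : E N) : ℝ :=
  ∫ z, spow (posPow s (lastCoord hN w) - posPow s (lastCoord hN z)) (p - 1) *
    kernelDiff (-(N : ℝ) - p * s) Φ w z

lemma neg_natCast_sub_mul_neg (N : ℕ) (hs : 0 < s) (hp : 0 < p) : -(N : ℝ) - p * s < 0 := by
  have : (0 : ℝ) ≤ N := N.cast_nonneg
  nlinarith [mul_pos hp hs]

lemma exists_integrable_bound_mul_kernelDiff [Nontrivial (E N)] (hs0 : 0 < s) (hs1 : s < 1)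
    (hp : 1 < p) (hM' : 0 < M') (hR : 0 < R) :
    ∃ C : ℝ, 0 ≤ C ∧ ∀ (Φ : E N ≃ E N) (K : ℝ≥0), HasC11Bounds Φ R M M' K → ∀ w,
      ∃ G : E N → ℝ, Integrable G ∧ ∫ z, G z ≤ C * K ∧ ∀ (t : ℝ) (z : E N),
        |t| ≤ ‖w - z‖ ^ (s * (p - 1)) → |t * kernelDiff (-(N : ℝ) - p * s) Φ w z| ≤ G z := by
  obtain ⟨C, hC0, hC⟩ := exists_abs_kernelDiff_le (F := E N) (M := M)
    (neg_natCast_sub_mul_neg N hs0 (one_pos.trans hp)) hM' hR.le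
  have hint := integrable_min_norm_mul_rpow (F := E N) volume hs0 hs1 R hR
  rw [finrank_euclideanSpace_fin] at hint
  set k : E N → ℝ := fun h => min ‖h‖ R * ‖h‖ ^ (-(N : ℝ) - s)
  have hk0 : ∀ h, 0 ≤ k h := fun h => mul_nonneg (le_min (norm_nonneg _) hR.le) (by positivity)
  refine ⟨C * ∫ h, k h, mul_nonneg hC0 (integral_nonneg hk0), fun Φ K h w =>
    ⟨fun z => C * K * k (w - z), (hint.comp_sub_left w).const_mul _, ?_, fun t z ht => ?_⟩⟩
  · rw [integral_const_mul, integral_sub_left_eq_self k]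
    exact (mul_right_comm _ _ _).le
  · rcases eq_or_ne w z with rfl | hwz
    · simpa [kernelDiff] using mul_nonneg (mul_nonneg hC0 K.coe_nonneg) (hk0 _)
    calc |t * kernelDiff (-(N : ℝ) - p * s) Φ w z|
        ≤ ‖w - z‖ ^ (s * (p - 1)) *
          (C * K * (min ‖w - z‖ R * ‖w - z‖ ^ (-(N : ℝ) - p * s))) := by
          rw [abs_mul]
          gcongr
          exact hC Φ K h w z
      _ = C * K * k (w - z) := by
          simp only [k]
          rw [← rpow_mul_rpow_neg_sub N s p (norm_pos_iff.2 (sub_ne_zero.2 hwz))]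
          ring

lemma exists_abs_integral_mul_kernelDiff_le [Nontrivial (E N)] (hs0 : 0 < s) (hs1 : s < 1)
    (hp : 1 < p) (hM' : 0 < M') (hR : 0 < R) :
    ∃ C : ℝ, 0 ≤ C ∧ ∀ (Φ : E N ≃ E N) (K : ℝ≥0), HasC11Bounds Φ R M M' K →
      ∀ (w : E N) (T : E N → ℝ), (∀ z, |T z| ≤ ‖w - z‖ ^ (s * (p - 1))) →
        |∫ z, T z * kernelDiff (-(N : ℝ) - p * s) Φ w z| ≤ C * K := by
  obtain ⟨C, hC0, hC⟩ := exists_integrable_bound_mul_kernelDiff (N := N) (M := M) hs0 hs1 hp hM' hR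
  refine ⟨C, hC0, fun Φ K h w T hT => ?_⟩
  obtain ⟨G, hG, hGle, hbound⟩ := hC Φ K h w
  rw [← Real.norm_eq_abs]
  exact (norm_integral_le_of_norm_le hG
    (Eventually.of_forall fun z => hbound (T z) z (hT z))).trans hGle

lemma abs_lastCoord_sub_rpow_le (hN : 1 ≤ N) (hs : 0 ≤ s) (hp : 1 ≤ p) (w z : E N) :
    |lastCoord hN w - lastCoord hN z| ^ (s * (p - 1)) ≤ ‖w - z‖ ^ (s * (p - 1)) :=
  Real.rpow_le_rpow (abs_nonneg _) (abs_lastCoord_sub_le hN w z)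
    (mul_nonneg hs (sub_nonneg.2 hp))

lemma exists_abs_residual_le (hN : 1 ≤ N) (hs0 : 0 < s) (hs1 : s < 1) (hp : 1 < p) (hM' : 0 < M')
    (hR : 0 < R) :
    ∃ C : ℝ≥0, ∀ (Φ : E N ≃ E N) (K : ℝ≥0), HasC11Bounds Φ R M M' K → ∀ w,
      |residual hN s p Φ w| ≤ C * K := by
  have := nontrivial_E hN
  obtain ⟨C, hC0, hC⟩ := exists_abs_integral_mul_kernelDiff_le (N := N) (M := M) hs0 hs1 hp hM' hR
  exact ⟨⟨C, hC0⟩, fun Φ K h w => hC Φ K h w _ fun z =>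
    (abs_spow_posPow_sub_le hs0.le hs1.le hp _ _).trans
      (abs_lastCoord_sub_rpow_le hN hs0.le hp.le w z)⟩

lemma measurable_truncInt_lastCoord (hN : 1 ≤ N) (hs : 0 ≤ s) (p l a : ℝ) :
    Measurable fun z : E N => truncInt s p l a (lastCoord hN z) :=
  (measurable_truncInt hs p l).comp
    (measurable_const.prodMk (continuous_lastCoord hN).measurable)

lemma integrable_truncInt_mul_norm_rpow (hN : 1 ≤ N) (hs0 : 0 < s) (hs1 : s ≤ 1) (hp : 1 < p)
    (hl0 : 0 ≤ l) (hl1 : l < 1) (hM' : 0 < M') {A : E N →L[ℝ] E N} (hA : ∀ v, ‖v‖ ≤ M' * ‖A v‖)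
    (hw : 0 < lastCoord hN w) :
    Integrable fun z => truncInt s p l (lastCoord hN w) (lastCoord hN z) *
      ‖A (w - z)‖ ^ (-(N : ℝ) - p * s) := by
  have := nontrivial_E hN
  have hβ := neg_natCast_sub_mul_neg N hs0 (one_pos.trans hp)
  have hint := integrable_truncKernel_right hs0 hs1 hp hl0 hl1
    (lipschitzWith_lastCoord hN) one_pos hw
  refine (hint.abs.const_mul (M' ^ (-(-(N : ℝ) - p * s)) : ℝ)).mono'
    ((measurable_truncInt_lastCoord hN hs0.le p l _).mul (by fun_prop)).aestronglyMeasurable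
    (Eventually.of_forall fun z => ?_)
  rw [norm_mul, Real.norm_eq_abs, Real.norm_of_nonneg (by positivity), truncKernel, abs_mul,
    abs_of_nonneg (Real.rpow_nonneg (norm_nonneg _) _), mul_left_comm]
  gcongr
  rcases eq_or_ne w z with rfl | hwz
  · simp [Real.zero_rpow hβ.ne]
  · exact rpow_le_mul_rpow_of_le_mul hβ.le hM' (norm_pos_iff.2 (sub_ne_zero.2 hwz)) (hA _)

/-- Integrating out the tangential variables reduces the frozen operator to dimension one. -/
lemma exists_integral_truncInt_mul_norm_rpow (hN : 1 ≤ N) (hs0 : 0 < s) (hs1 : s ≤ 1) (hp : 1 < p)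
    (hM' : 0 < M') :
    ∃ B : ℝ, 0 ≤ B ∧ ∀ A : E N →L[ℝ] E N, (∀ v, ‖v‖ ≤ M' * ‖A v‖) → ∃ c, |c| ≤ B ∧
      ∀ w, 0 < lastCoord hN w → ∀ l ∈ Ioo (0 : ℝ) 1,
        ∫ z, truncInt s p l (lastCoord hN w) (lastCoord hN z) *
          ‖A (w - z)‖ ^ (-(N : ℝ) - p * s) = c * (lastCoord hN w ^ (-s) * truncConst s p l) := by
  have hM'0 : (0 : ℝ) < M' := hM'
  obtain ⟨B, hB0, hB⟩ := exists_integral_lastCoord_mul_norm_rpow (G := E N) hN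
    (mul_pos (one_pos.trans hp) hs0) (inv_pos.2 hM'0)
  refine ⟨B, hB0, fun A hA => ?_⟩
  obtain ⟨c, hcB, hc⟩ := hB A fun v => (inv_mul_le_iff₀ hM'0).2 (hA v)
  refine ⟨c, hcB, fun w hw l hl => ?_⟩
  have hsub : ∀ h, lastCoord hN (w - h) = lastCoord hN w - lastCoord hN h := fun _ => rfl
  have hint := (integrable_truncInt_mul_norm_rpow hN hs0 hs1 hp hl.1.le hl.2 hM' hA
    hw).comp_sub_left w
  simp only [sub_sub_cancel, hsub] at hint
  rw [← integral_truncInt_sub hs0 hs1 hp hl.1.le hl.2 hw, ← hc _ hint,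
    ← integral_sub_left_eq_self _ volume w]
  simp only [sub_sub_cancel, hsub]

lemma integrable_truncInt_mul_kernelDiff (h : HasC11Bounds Φ R M M' K) (hN : 1 ≤ N) (hs0 : 0 < s)
    (hs1 : s < 1) (hp : 1 < p) (hM' : 0 < M') (hR : 0 < R) (l : ℝ) (w : E N) :
    Integrable fun z => truncInt s p l (lastCoord hN w) (lastCoord hN z) *
      kernelDiff (-(N : ℝ) - p * s) Φ w z := by
  have := nontrivial_E hN
  obtain ⟨C, -, hC⟩ := exists_integrable_bound_mul_kernelDiff (N := N) (M := M) hs0 hs1 hp hM' hR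
  obtain ⟨G, hG, -, hbound⟩ := hC Φ K h w
  exact hG.mono' ((measurable_truncInt_lastCoord hN hs0.le p l _).mul
    ((h.measurable_kernelDiff _).comp measurable_prodMk_left)).aestronglyMeasurable
    (Eventually.of_forall fun z => hbound _ z ((abs_truncInt_le hs0.le hs1.le hp l _ _).trans
      (abs_lastCoord_sub_rpow_le hN hs0.le hp.le w z)))

lemma truncOp_height_eq (h : HasC11Bounds Φ R M M' K) (hN : 1 ≤ N) (hs0 : 0 < s) (hs1 : s < 1)
    (hp : 1 < p) (hM' : 0 < M') (hR : 0 < R) (hl0 : 0 ≤ l) (hl1 : l < 1)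
    (hw : 0 < lastCoord hN w) :
    truncOp s p l (height hN Φ) (Φ w) =
      (∫ z, truncInt s p l (lastCoord hN w) (lastCoord hN z) *
        kernelDiff (-(N : ℝ) - p * s) Φ w z) +
      |(fderiv ℝ Φ w).det| * ∫ z, truncInt s p l (lastCoord hN w) (lastCoord hN z) *
        ‖fderiv ℝ Φ w (w - z)‖ ^ (-(N : ℝ) - p * s) := by
  have hfrozen := integrable_truncInt_mul_norm_rpow hN hs0 hs1.le hp hl0 hl1 hM'
    (h.norm_le_mul_norm_fderiv w) hw
  rw [← integral_const_mul, ← integral_add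
    (integrable_truncInt_mul_kernelDiff h hN hs0 hs1 hp hM' hR l w) (hfrozen.const_mul _), truncOp,
    integral_eq_integral_abs_det_fderiv_mul volume h.differentiable]
  refine integral_congr_ae (Eventually.of_forall fun z => ?_)
  simp only [truncKernel, height, Equiv.symm_apply_apply, kernelDiff]
  ring

lemma tendsto_integral_truncInt_mul_kernelDiff (h : HasC11Bounds Φ R M M' K) (hN : 1 ≤ N)
    (hs0 : 0 < s) (hs1 : s < 1) (hp : 1 < p) (hM' : 0 < M') (hR : 0 < R) (w : E N) :
    Tendsto (fun l => ∫ z, truncInt s p l (lastCoord hN w) (lastCoord hN z) *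
      kernelDiff (-(N : ℝ) - p * s) Φ w z) (𝓝[<] 1) (𝓝 (residual hN s p Φ w)) := by
  have := nontrivial_E hN
  obtain ⟨C, -, hC⟩ := exists_integrable_bound_mul_kernelDiff (N := N) (M := M) hs0 hs1 hp hM' hR
  obtain ⟨G, hG, -, hbound⟩ := hC Φ K h w
  refine tendsto_integral_filter_of_dominated_convergence G
    (Eventually.of_forall fun l =>
      (integrable_truncInt_mul_kernelDiff h hN hs0 hs1 hp hM' hR l w).aestronglyMeasurable)
    (Eventually.of_forall fun l => Eventually.of_forall fun z => hbound _ z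
      ((abs_truncInt_le hs0.le hs1.le hp l _ _).trans
        (abs_lastCoord_sub_rpow_le hN hs0.le hp.le w z))) hG
    (Eventually.of_forall fun z => (tendsto_nhds_of_eventually_eq ?_).mul_const _)
  exact eventually_truncInt_eq s p (lastCoord hN w) (lastCoord hN z)

lemma exists_abs_truncOp_height_le (h : HasC11Bounds Φ R M M' K) (hN : 1 ≤ N) (hs0 : 0 < s)
    (hs1 : s < 1) (hp : 1 < p) (hM' : 0 < M') (hR : 0 < R) :
    ∃ C₁ C₂ : ℝ, ∀ x, 0 < height hN Φ x → ∀ l ∈ Ioo (0 : ℝ) 1,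
      |truncOp s p l (height hN Φ) x| ≤ C₁ + C₂ * height hN Φ x ^ (-s) := by
  have := nontrivial_E hN
  obtain ⟨C, -, hC⟩ := exists_abs_integral_mul_kernelDiff_le (N := N) (M := M) hs0 hs1 hp hM' hR
  obtain ⟨B, hB0, hB⟩ := exists_integral_truncInt_mul_norm_rpow hN hs0 hs1.le hp hM'
  obtain ⟨L, hL0, hL, -⟩ := exists_abs_det_bounds (F := E N) M
  refine ⟨C * K, L * (B * (1 / (p * s))), fun x hx l hl => ?_⟩
  set w := Φ.symm x with hw
  have hx : 0 < lastCoord hN w := hx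
  obtain ⟨c, hcB, hc⟩ := hB (fderiv ℝ Φ w) (h.norm_le_mul_norm_fderiv w)
  have hdiff : |∫ z, truncInt s p l (lastCoord hN w) (lastCoord hN z) *
      kernelDiff (-(N : ℝ) - p * s) Φ w z| ≤ C * K :=
    hC Φ K h w _ fun z => (abs_truncInt_le hs0.le hs1.le hp l _ _).trans
      (abs_lastCoord_sub_rpow_le hN hs0.le hp.le w z)
  have hconst0 := truncConst_nonneg hs0.le (one_pos.trans hp).le hl.1.le hl.2.le
  have hconst := truncConst_le_inv hs0 hs1.le (one_pos.trans hp).le hl.1.le hl.2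
  have hpow : 0 ≤ lastCoord hN w ^ (-s) := Real.rpow_nonneg hx.le _
  rw [← Φ.apply_symm_apply x, ← hw, truncOp_height_eq h hN hs0 hs1 hp hM' hR hl.1.le hl.2 hx,
    hc w hx l hl, height, Φ.symm_apply_apply]
  refine (abs_add_le _ _).trans (add_le_add hdiff ?_)
  rw [abs_mul, abs_abs, abs_mul, abs_of_nonneg (mul_nonneg hpow hconst0)]
  calc _ ≤ L * (B * (lastCoord hN w ^ (-s) * (1 / (p * s)))) := by
        gcongr
        exact hL _ (h.nnnorm_fderiv_le w)
    _ = _ := by ring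

lemma tendsto_truncOp_height (h : HasC11Bounds Φ R M M' K) (hN : 1 ≤ N) (hs0 : 0 < s)
    (hs1 : s < 1) (hp : 1 < p) (hM' : 0 < M') (hR : 0 < R) {x : E N} (hx : 0 < height hN Φ x) :
    Tendsto (fun l => truncOp s p l (height hN Φ) x) (𝓝[<] 1)
      (𝓝 (residual hN s p Φ (Φ.symm x))) := by
  obtain ⟨B, -, hB⟩ := exists_integral_truncInt_mul_norm_rpow hN hs0 hs1.le hp hM'
  set w := Φ.symm x with hw
  obtain ⟨c, -, hc⟩ := hB (fderiv ℝ Φ w) (h.norm_le_mul_norm_fderiv w)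
  have hfrozen := ((tendsto_truncConst hs0 hs1 (one_pos.trans hp)).const_mul
    (lastCoord hN w ^ (-s))).const_mul c |>.const_mul |(fderiv ℝ Φ w).det|
  have hlim := (tendsto_integral_truncInt_mul_kernelDiff h hN hs0 hs1 hp hM' hR w).add hfrozen
  simp only [mul_zero, add_zero] at hlim
  refine hlim.congr' ?_
  filter_upwards [Ioo_mem_nhdsLT (one_pos (α := ℝ))] with l hl
  rw [← Φ.apply_symm_apply x, ← hw, truncOp_height_eq h hN hs0 hs1 hp hM' hR hl.1.le hl.2 hx,
    hc w hx l hl]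

end Transported

lemma HasC11Bounds.integrableOn_comp_symm {F : Type*} [NormedAddCommGroup F] [NormedSpace ℝ F]
    [FiniteDimensional ℝ F] [MeasurableSpace F] [BorelSpace F] {μ : Measure F}
    [μ.IsAddHaarMeasure] {Φ : F ≃ F} {R : ℝ} {M M' K : ℝ≥0} (h : HasC11Bounds Φ R M M' K)
    {f : F → ℝ} {S : Set F} (hS : MeasurableSet S) (hf : IntegrableOn f (Φ ⁻¹' S) μ) :
    IntegrableOn (fun x => f (Φ.symm x)) S μ := by
  obtain ⟨L, -, hL, -⟩ := exists_abs_det_bounds (F := F) M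
  have hmS : MeasurableSet (Φ ⁻¹' S) := h.lipschitzWith.continuous.measurable hS
  rw [← Φ.image_preimage S, integrableOn_image_iff_integrableOn_abs_det_fderiv_smul μ hmS
    (fun z _ => (h.differentiable z).hasFDerivAt.hasFDerivWithinAt) Φ.injective.injOn]
  simp only [Φ.symm_apply_apply, smul_eq_mul]
  have hdet : Continuous fun z => |(fderiv ℝ Φ z).det| :=
    ((contDiff_det (k := 0)).continuous.comp h.continuous_fderiv).abs
  exact hf.bdd_mul hdet.aestronglyMeasurable
    (Eventually.of_forall fun z => by simpa using hL _ (h.nnnorm_fderiv_le z))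

section Height

variable {N : ℕ} {s p R : ℝ} {M M' K : ℝ≥0} {Φ : E N ≃ E N} {Ω : Set (E N)}

lemma HasExteriorBalls.mono {κ D : ℝ} {δ : E N → ℝ} {Ω' : Set (E N)}
    (h : HasExteriorBalls Ω δ κ D) (hsub : Ω' ⊆ Ω) : HasExteriorBalls Ω' δ κ D := fun x hx => by
  obtain ⟨hδ, c, hc⟩ := h x (hsub hx)
  exact ⟨hδ, c, fun y hy => ⟨fun hy' => (hc y hy).1 (hsub hy'), (hc y hy).2⟩⟩

namespace HasC11Bounds

lemma lipschitzWith_height (h : HasC11Bounds Φ R M M' K) (hN : 1 ≤ N) :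
    LipschitzWith M' (height hN Φ) := by
  have := (lipschitzWith_lastCoord hN).comp h.lipschitzWith_symm
  rwa [one_mul] at this

lemma integrableOn_abs_height_rpow (h : HasC11Bounds Φ R M M' K) (hN : 1 ≤ N) {b : ℝ}
    (hb : -1 < b) (ρ : ℝ) :
    IntegrableOn (fun x => |height hN Φ x| ^ b) (Metric.ball 0 ρ) := by
  obtain ⟨ρ', hρ'⟩ := (h.lipschitzWith_symm.isBounded_image
    (Metric.isBounded_ball (x := (0 : E N)) (r := ρ))).subset_ball 0
  rw [Φ.symm.image_eq_preimage_symm, Φ.symm_symm] at hρ'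
  refine h.integrableOn_comp_symm (f := fun z => |lastCoord hN z| ^ b) measurableSet_ball
    (IntegrableOn.mono_set ⟨?_, ?_⟩ hρ')
  · exact ((continuous_lastCoord hN).measurable.abs.pow_const b).aestronglyMeasurable
  · rw [hasFiniteIntegral_iff_ofReal (Eventually.of_forall fun x => by positivity)]
    exact lintegral_ball_abs_lastCoord_rpow_lt_top hN hb ρ'

lemma integrableOn_gagliardo (h : HasC11Bounds Φ R M M' K) (hN : 1 ≤ N) (hs0 : 0 < s)
    (hs1 : s < 1) (hp : 1 ≤ p) (ρ : ℝ) :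
    IntegrableOn (gagliardo s p fun x => posPow s (height hN Φ x))
      (Metric.ball 0 ρ ×ˢ Metric.ball 0 ρ) :=
  have := nontrivial_E hN
  integrableOn_gagliardo_posPow_comp hs0 hs1 hp (h.lipschitzWith_height hN)
    (h.integrableOn_abs_height_rpow hN (by linarith) ρ)

lemma continuous_posPow_height (h : HasC11Bounds Φ R M M' K) (hN : 1 ≤ N) (hs : 0 ≤ s) :
    Continuous fun x => posPow s (height hN Φ x) :=
  (continuous_posPow hs).comp (h.lipschitzWith_height hN).continuous

lemma memWTildeLoc (h : HasC11Bounds Φ R M M' K) (hN : 1 ≤ N) (hs0 : 0 < s) (hs1 : s < 1)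
    (hp : 1 ≤ p) (Ω : Set (E N)) : MemWTildeLoc s p Ω fun x => posPow s (height hN Φ x) := by
  have hcont := h.continuous_posPow_height hN hs0.le
  obtain ⟨C, hC⟩ := exists_abs_posPow_comp_le hs0.le (h.lipschitzWith_height hN)
  exact ⟨memLpLoc_of_continuous p hcont, fun Ω' hΩ' _ => memWTilde_of_continuous hs0 hp hcont hC
    (h.integrableOn_gagliardo hN hs0 hs1 hp) hΩ'⟩

lemma hasExteriorBalls (h : HasC11Bounds Φ R M M' K) (hN : 1 ≤ N) (hM' : 0 < M') :
    HasExteriorBalls (Φ '' halfSpace hN) (height hN Φ) (1 / M') (2 * M + 1 / M') := by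
  have : (0 : ℝ) < M' := hM'
  rintro _ ⟨w, hw, rfl⟩
  rw [height, Φ.symm_apply_apply]
  set a := lastCoord hN w with ha
  have hw : 0 < a := hw
  -- The centre is the image of the reflection of `w` in the boundary of the half-space.
  set w' : E N := w - EuclideanSpace.single ⟨N - 1, Nat.sub_one_lt_of_lt hN⟩ (2 * a) with hw'
  have hcoord : lastCoord hN w' = -a := by
    simp [lastCoord, hw', ha]
    ring
  have hdist : ‖w - w'‖ = 2 * a := by
    rw [hw', sub_sub_cancel, PiLp.norm_single, Real.norm_of_nonneg (by positivity)]
  refine ⟨hw, Φ w', fun y hy => ?_⟩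
  rw [mem_ball_iff_norm] at hy
  refine ⟨?_, ?_⟩
  · rintro ⟨z, hz, rfl⟩
    have hz : 0 < lastCoord hN z := hz
    have hlt : |lastCoord hN z - lastCoord hN w'| < a :=
      calc |lastCoord hN z - lastCoord hN w'| ≤ ‖z - w'‖ := abs_lastCoord_sub_le hN z w'
        _ ≤ M' * ‖Φ z - Φ w'‖ := h.norm_sub_le z w'
        _ < M' * (1 / M' * a) := by gcongr
        _ = a := by field_simp
    rw [hcoord] at hlt
    linarith [(abs_lt.1 hlt).2]
  · calc ‖Φ w - y‖ ≤ ‖Φ w - Φ w'‖ + ‖Φ w' - y‖ := norm_sub_le_norm_sub_add_norm_sub _ _ _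
      _ ≤ M * (2 * a) + 1 / M' * a := by
        rw [norm_sub_rev (Φ w')]
        gcongr
        exact (h.lipschitzWith.norm_sub_le w w').trans_eq (by rw [hdist])
      _ = (2 * M + 1 / M') * a := by ring

lemma measurable_residual (h : HasC11Bounds Φ R M M' K) (hN : 1 ≤ N) (hs : 0 ≤ s) (p : ℝ) :
    Measurable (residual hN s p Φ) := by
  have hpow : Measurable fun x : E N => posPow s (lastCoord hN x) :=
    ((continuous_posPow hs).comp (continuous_lastCoord hN)).measurable
  have hker := ((measurable_spow (p - 1)).comp
    ((hpow.comp measurable_fst).sub (hpow.comp measurable_snd))).mul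
    (h.measurable_kernelDiff (-(N : ℝ) - p * s))
  exact hker.stronglyMeasurable.integral_prod_right.measurable

lemma measurable_two_mul_residual_symm (h : HasC11Bounds Φ R M M' K) (hN : 1 ≤ N) (hs : 0 ≤ s)
    (p : ℝ) : Measurable fun x => 2 * residual hN s p Φ (Φ.symm x) :=
  ((h.measurable_residual hN hs p).comp h.lipschitzWith_symm.continuous.measurable).const_mul 2

lemma integrable_weakForm (h : HasC11Bounds Φ R M M' K) (hN : 1 ≤ N) (hs0 : 0 < s) (hs1 : s < 1)
    (hp : 1 < p) (hΩ : Bornology.IsBounded Ω) {φ : E N → ℝ} (hφ : MemW0 s p Ω φ) :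
    Integrable (weakForm s p (fun x => posPow s (height hN Φ x)) φ) :=
  have := nontrivial_E hN
  hφ.integrable_weakForm hs0 hp hΩ
    (h.continuous_posPow_height hN hs0.le).aestronglyMeasurable (by positivity)
    (abs_posPow_comp_sub_le hs0.le hs1.le (h.lipschitzWith_height hN))
    (h.integrableOn_gagliardo hN hs0 hs1 hp.le)

lemma integral_weakForm_eq (h : HasC11Bounds Φ R M M' K) (hN : 1 ≤ N) (hs0 : 0 < s) (hs1 : s < 1)
    (hp : 1 < p) (hM' : 0 < M') (hR : 0 < R) (hΩ : Bornology.IsBounded Ω)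
    (hsub : Ω ⊆ Φ '' halfSpace hN) {φ : E N → ℝ} (hφ : MemW0 s p Ω φ) :
    ∫ z, weakForm s p (fun x => posPow s (height hN Φ x)) φ z =
      ∫ x in Ω, (2 * residual hN s p Φ (Φ.symm x)) * φ x := by
  have := nontrivial_E hN
  have hlip := h.lipschitzWith_height hN
  have hball := (h.hasExteriorBalls hN hM').mono hsub
  have hpos : ∀ x ∈ Ω, 0 < height hN Φ x := fun x hx => (hball x hx).1
  have : (0 : ℝ) < M' := hM'
  obtain ⟨C₁, C₂, hbound⟩ := exists_abs_truncOp_height_le h hN hs0 hs1 hp hM' hR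
  exact hφ.integral_weakForm_eq hs0 hs1.le hp hlip hM' hΩ hpos
    (hφ.integrable_mul_rpow_neg hs0.le hp.le (by positivity) (by positivity) hΩ
      hlip.continuous.measurable hball)
    (h.integrable_weakForm hN hs0 hs1 hp hΩ hφ) (fun x hx => hbound x (hpos x hx))
    fun x hx => tendsto_truncOp_height h hN hs0 hs1 hp hM' hR (hpos x hx)

lemma isWeakSol (h : HasC11Bounds Φ R M M' K) (hN : 1 ≤ N) (hs0 : 0 < s) (hs1 : s < 1)
    (hp : 1 < p) (hM' : 0 < M') (hR : 0 < R) :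
    IsWeakSol s p (Φ '' halfSpace hN) (fun x => posPow s (height hN Φ x))
      fun x => 2 * residual hN s p Φ (Φ.symm x) := by
  obtain ⟨C, hC⟩ := exists_abs_residual_le (M := M) hN hs0 hs1 hp hM' hR
  have hmem := h.memWTildeLoc hN hs0 hs1 hp.le (Φ '' halfSpace hN)
  refine ⟨hmem, fun Ω _ hΩ hsub => ⟨hmem.2 Ω hΩ hsub, memDual_of_bounded hp.le hΩ
    (h.measurable_two_mul_residual_symm hN hs0.le p).aestronglyMeasurable (C := 2 * (C * K))
    fun x => ?_, fun φ hφ => ⟨h.integrable_weakForm hN hs0 hs1 hp hΩ hφ,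
      h.integral_weakForm_eq hN hs0 hs1 hp hM' hR hΩ hsub hφ⟩⟩⟩
  rw [abs_mul, abs_two]
  exact mul_le_mul_of_nonneg_left (hC Φ K h _) zero_le_two

end HasC11Bounds

end Height

end FracPLap

theorem lemma3p4 {N : ℕ} (hN : 1 ≤ N) {s p : ℝ} (hs0 : 0 < s) (hs1 : s < 1) (hp : 1 < p)
    (M M' : ℝ≥0) {r : ℝ} (hr : 0 < r) :
    ∃ C : ℝ≥0, ∀ Φ : FracPLap.E N ≃ FracPLap.E N,
      FracPLap.IsC11Diffeo Φ →
      (∀ x, x ∉ Metric.ball 0 r → Φ x = x) →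
      FracPLap.supD Φ ≤ M → FracPLap.supD Φ.symm ≤ M' →
      FracPLap.MemWTildeLoc s p Set.univ
          (fun x => (max (FracPLap.lastCoord hN (Φ.symm x)) 0) ^ s) ∧
        ∃ f : FracPLap.E N → ℝ,
          MemLp f ∞ (volume.restrict (Φ '' FracPLap.halfSpace hN)) ∧
          FracPLap.IsWeakSol s p (Φ '' FracPLap.halfSpace hN)
            (fun x => (max (FracPLap.lastCoord hN (Φ.symm x)) 0) ^ s) f ∧
          eLpNorm f ∞ (volume.restrict (Φ '' FracPLap.halfSpace hN)) ≤
            C * FracPLap.supD2 Φ := by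
  have := FracPLap.nontrivial_E hN
  -- The kernel bounds divide by the bound on `DΦ⁻¹`, hence `M' + 1` in place of `M'`.
  have hM₁ : 0 < M' + 1 := by positivity
  have hR : 0 < 6 * r := by positivity
  obtain ⟨C, hC⟩ := FracPLap.exists_abs_residual_le (M := M) hN hs0 hs1 hp hM₁ hR
  refine ⟨2 * C, fun Φ hΦ hfix hM hM' => ?_⟩
  have h := hΦ.hasC11Bounds hr hfix hM
    (hM'.trans (ENNReal.coe_le_coe.2 (le_add_of_nonneg_right zero_le_one)))
  have htop := hΦ.1.supD2_ne_top
  have hbound : eLpNorm (fun x => 2 * FracPLap.residual hN s p Φ (Φ.symm x)) ∞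
      (volume.restrict (Φ '' FracPLap.halfSpace hN)) ≤ ↑(2 * C) * FracPLap.supD2 Φ := by
    rw [← ENNReal.coe_toNNReal htop, ← ENNReal.coe_mul, ← ENNReal.ofReal_coe_nnreal]
    refine eLpNormEssSup_le_of_ae_bound (Filter.Eventually.of_forall fun x => ?_)
    rw [norm_mul, Real.norm_two, NNReal.coe_mul, NNReal.coe_mul, mul_assoc]
    exact mul_le_mul_of_nonneg_left (hC Φ _ h _) zero_le_two
  exact ⟨h.memWTildeLoc hN hs0 hs1 hp.le _, _,
    ⟨(h.measurable_two_mul_residual_symm hN hs0.le p).aestronglyMeasurable,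
      hbound.trans_lt (ENNReal.mul_lt_top ENNReal.coe_lt_top htop.lt_top)⟩,
    h.isWeakSol hN hs0 hs1 hp hM₁ hR, hbound⟩
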